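/- A \emph{family} of subgroups of a group $G$ is a non-empty set $\mathfrak F$ of subgroups of $G$ that is closed under conjugation and under finite intersections. The orbit category $\mathcal O_{\mathfrak F}G$ has as objects the $G$-sets $G/H$ with $H\in\mathfrak F$ and as morphisms all $G$-maps. A right (left) $\mathcal O_{\mathfrak F}G$-module is a contravariant (covariant) functor from $\mathcal O_{\mathfrak F}G$ to abelian groups. For a right module $M$ and a left module $N$, let $M\otimes_{\mathfrak F}N$ be the quotient of $\bigoplus_{H\in\mathfrak F}M(G/H)\otimes N(G/H)$ by the relations $\varphi^*m\otimes n=m\otimes\varphi_*n$; the right module $M$ is flat if all the higher left derived functors of $?\otimes_{\mathfrak F}N$ vanish on $M$, for every left module $N$. The Bredon cohomological dimension $\mathrm{cd}_{\mathfrak F}G$ is the projective dimension, and the Bredon homological dimension $\mathrm{hd}_{\mathfrak F}G$ is the flat dimension (the least length of a flat resolution, $\infty$ if there is no finite one), of the constant right module $\underline{\mathbb Z}$. \textbf{Proposition.} Let $G$ be a group that is the directed union of subgroups $G_\lambda$, $\lambda\in\Lambda$, and let $\mathfrak F$ be a family of subgroups of $G$. For each $\lambda$ put $\mathfrak F_\lambda=\mathfrak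 F\cap G_\lambda=\{H\cap G_\lambda\mid H\in\mathfrak F\}$, which is a family of subgroups of $G_\lambda$, and suppose that $\mathfrak F=\bigcup_{\lambda\in\Lambda}\mathfrak F_\lambda$. Then \begin{enumerate} \item[(i)] $\mathrm{hd}_{\mathfrak F}G=\sup_{\lambda\in\Lambda}\mathrm{hd}_{\mathfrak F_\lambda}G_\lambda$; \item[(ii)] if $\Lambda$ is countable, then $\mathrm{cd}_{\mathfrak F}G\le\sup_{\lambda\in\Lambda}\mathrm{cd}_{\mathfrak F_\lambda}G_\lambda+1$. \end{enumerate} All dimensions and suprema may be infinite. -/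

import Mathlib

open CategoryTheory Opposite
open scoped TensorProduct DirectSum

universe u

namespace BredonTheory

/-! ### Families of subgroups -/

/-- A *family* of subgroups of `G`: a non-empty set of subgroups which is closed under
conjugation and under finite intersections. -/
structure IsFamily {G : Type u} [Group G] (F : Set (Subgroup G)) : Prop where
  nonempty : F.Nonempty
  conj_mem : ∀ H ∈ F, ∀ g : G, H.map (MulAut.conj g).toMonoidHom ∈ F
  inf_mem : ∀ H ∈ F, ∀ K ∈ F, H ⊓ K ∈ F

/-- `F ∩ K = {H ∩ K | H ∈ F}`, as a set of subgroups of the group `K`. -/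
def restrictFamily {G : Type u} [Group G] (F : Set (Subgroup G)) (K : Subgroup G) :
    Set (Subgroup K) :=
  {L | ∃ H ∈ F, L = H.subgroupOf K}

/-! ### The orbit category -/

/-- Objects of the orbit category of `G` with respect to `F`: the object given by `H ∈ F`
stands for the transitive `G`-set `G ⧸ H`. -/
structure OrbitCat {G : Type u} [Group G] (F : Set (Subgroup G)) : Type u where
  sub : Subgroup G
  mem : sub ∈ F

/-- Morphisms of the orbit category are all `G`-maps `G ⧸ H → G ⧸ K`. -/
instance {G : Type u} [Group G] (F : Set (Subgroup G)) : SmallCategory (OrbitCat F) where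
  Hom X Y := (G ⧸ X.sub) →[G] (G ⧸ Y.sub)
  id X := MulActionHom.id G
  comp f g := MulActionHom.comp g f

/-! ### Bredon modules over a small category -/

/-- Right modules: contravariant functors to abelian groups. -/
abbrev RightMod (C : Type u) [SmallCategory C] := Cᵒᵖ ⥤ AddCommGrpCat.{u}

/-- Left modules: covariant functors to abelian groups. -/
abbrev LeftMod (C : Type u) [SmallCategory C] := C ⥤ AddCommGrpCat.{u}

/-- The trivial right module: constant with value `ℤ`, all morphisms act as the identity. -/
def trivialMod (C : Type u) [SmallCategory C] : RightMod C :=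
  (Functor.const _).obj (AddCommGrpCat.of (ULift.{u} ℤ))

section EnoughProjectives

instance enoughProjectives_addCommGrpCat : EnoughProjectives AddCommGrpCat.{u} :=
  ((forget₂ (ModuleCat.{u} ℤ) AddCommGrpCat.{u}).asEquivalence.enoughProjectives_iff).1
    inferInstance

theorem projective_freeYoneda {C : Type u} [SmallCategory C] (X : C) (A : AddCommGrpCat.{u})
    [Projective A] : Projective (Presheaf.freeYoneda X A) where
  factors {E M} f e he := by
    have : Epi (e.app (op X)) := inferInstance
    refine ⟨Presheaf.freeYonedaHomEquiv.symm
      (Projective.factorThru (Presheaf.freeYonedaHomEquiv f) (e.app (op X))), ?_⟩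
    rw [Presheaf.freeYonedaHomEquiv_symm_comp, Projective.factorThru_comp,
      Equiv.symm_apply_apply]

/-- The category of right modules has enough projectives, so that derived functors exist. -/
instance enoughProjectives_rightMod (C : Type u) [SmallCategory C] :
    EnoughProjectives (RightMod C) where
  presentation M := by
    let P : C → RightMod C := fun X => Presheaf.freeYoneda X (Projective.over (M.obj (op X)))
    let p : ∀ X, P X ⟶ M := fun X =>
      Presheaf.freeYonedaHomEquiv.symm (Projective.π (M.obj (op X)))
    have hP : ∀ X, Projective (P X) := fun X => projective_freeYoneda X _
    have hepi : Epi (Limits.Sigma.desc p) := by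
      rw [NatTrans.epi_iff_epi_app]
      rintro ⟨X⟩
      have h : Presheaf.freeYonedaHomEquiv (p X) = Projective.π (M.obj (op X)) :=
        Equiv.apply_symm_apply _ _
      have h2 : (Limits.Sigma.ι P X).app (op X) ≫ (Limits.Sigma.desc p).app (op X)
          = (p X).app (op X) := by
        rw [← NatTrans.comp_app, Limits.Sigma.ι_desc]
      have h3 : Epi ((p X).app (op X)) := by
        have : Epi (Presheaf.freeYonedaHomEquiv (p X)) := by rw [h]; infer_instance
        exact epi_of_epi_fac
          (show _ ≫ (p X).app (op X) = Presheaf.freeYonedaHomEquiv (p X) from rfl)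
      exact epi_of_epi_fac h2
    exact ⟨{ p := ∐ P, f := Limits.Sigma.desc p }⟩

end EnoughProjectives

/-! ### The tensor product over a small category -/

section Tensor

variable {C : Type u} [SmallCategory C]

/-- The direct sum of the groups `M(c) ⊗ N(c)` over all objects `c`. -/
abbrev PreTensor (M : RightMod C) (N : LeftMod C) : Type u :=
  ⨁ c : C, (M.obj (op c)) ⊗[ℤ] (N.obj c)

open Classical in
/-- The subgroup generated by all `φ^* m ⊗ n - m ⊗ φ_* n`, for morphisms `φ : c ⟶ d` and
elements `m ∈ M(d)`, `n ∈ N(c)`. -/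
def tensorRel (M : RightMod C) (N : LeftMod C) : AddSubgroup (PreTensor M N) :=
  AddSubgroup.closure
    {z | ∃ (c d : C) (φ : c ⟶ d) (m : M.obj (op d)) (n : N.obj c),
      z = DirectSum.of (fun c : C => (M.obj (op c)) ⊗[ℤ] (N.obj c)) c
            ((M.map φ.op).hom m ⊗ₜ[ℤ] n)
        - DirectSum.of (fun c : C => (M.obj (op c)) ⊗[ℤ] (N.obj c)) d
            (m ⊗ₜ[ℤ] (N.map φ).hom n)}

/-- The map induced by a morphism of right modules on the direct sums. -/
def preTensorMap {M M' : RightMod C} (f : M ⟶ M') (N : LeftMod C) :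
    PreTensor M N →+ PreTensor M' N :=
  DirectSum.map fun c =>
    (TensorProduct.map (f.app (op c)).hom.toIntLinearMap
      (LinearMap.id : N.obj c →ₗ[ℤ] N.obj c)).toAddMonoidHom

theorem tensorRel_le_comap {M M' : RightMod C} (f : M ⟶ M') (N : LeftMod C) :
    tensorRel M N ≤ (tensorRel M' N).comap (preTensorMap f N) := by
  classical
  rw [tensorRel, AddSubgroup.closure_le]
  rintro _ ⟨c, d, φ, m, n, rfl⟩
  refine AddSubgroup.subset_closure ⟨c, d, φ, (f.app (op d)).hom m, n, ?_⟩
  have h : (f.app (op c)).hom ((M.map φ.op).hom m) = (M'.map φ.op).hom ((f.app (op d)).hom m) :=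
    congrArg (fun k => k.hom m) (f.naturality φ.op)
  rw [map_sub, preTensorMap, DirectSum.map_of, DirectSum.map_of]
  simp [h]

/-- The tensor product `M ⊗ N` over `C`: the quotient of the direct sum of all `M(c) ⊗ N(c)`
by the relations `φ^* m ⊗ n = m ⊗ φ_* n`. It is a functor of the right module `M`. -/
def tensorFunctor (N : LeftMod C) : RightMod C ⥤ AddCommGrpCat.{u} where
  obj M := AddCommGrpCat.of (PreTensor M N ⧸ tensorRel M N)
  map {M M'} f := AddCommGrpCat.ofHom
    (QuotientAddGroup.map _ _ (preTensorMap f N) (tensorRel_le_comap f N))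
  map_id M := by
    have h : preTensorMap (𝟙 M) N = AddMonoidHom.id _ := by
      classical
      refine DirectSum.addHom_ext' fun c => AddMonoidHom.ext fun y => ?_
      induction y using TensorProduct.induction_on with
      | zero => simp
      | add a b ha hb => rw [map_add, map_add, ha, hb]
      | tmul a b => simp [preTensorMap, DirectSum.map_of]
    ext x
    simp [h]
  map_comp {M M' M''} f g := by
    have h : preTensorMap (f ≫ g) N = (preTensorMap g N).comp (preTensorMap f N) := by
      classical
      refine DirectSum.addHom_ext' fun c => AddMonoidHom.ext fun y => ?_
      induction y using TensorProduct.induction_on with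
      | zero => simp
      | add a b ha hb => rw [map_add, map_add, ha, hb]
      | tmul a b => simp [preTensorMap, DirectSum.map_of]
    ext x
    simp [h]

instance (N : LeftMod C) : (tensorFunctor N).Additive where
  map_add {M M'} f g := by
    have h : preTensorMap (f + g) N = preTensorMap f N + preTensorMap g N := by
      classical
      refine DirectSum.addHom_ext' fun c => AddMonoidHom.ext fun y => ?_
      induction y using TensorProduct.induction_on with
      | zero => simp
      | add a b ha hb => rw [map_add, map_add, ha, hb]
      | tmul a b => simp [preTensorMap, DirectSum.map_of, TensorProduct.add_tmul]
    ext x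
    obtain ⟨x, rfl⟩ := QuotientAddGroup.mk_surjective x
    simp only [tensorFunctor, h]
    rfl

/-- `Tor_i(M, N)`: the `i`-th left derived functor of `? ⊗ N`, evaluated at `M`. -/
noncomputable def tor (i : ℕ) (M : RightMod C) (N : LeftMod C) : AddCommGrpCat.{u} :=
  ((tensorFunctor N).leftDerived i).obj M

/-! ### Flat modules and flat dimension -/

/-- `M` is flat if it is `? ⊗ N`-acyclic for every left module `N`. -/
def IsFlat (M : RightMod C) : Prop :=
  ∀ (N : LeftMod C) (i : ℕ), 0 < i → Limits.IsZero (tor i M N)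

/-- `HasFlatResolution n M`: there is an exact sequence
`0 → F_n → ⋯ → F_1 → F_0 → M → 0` with all `F_i` flat. The sequence is given step by step,
through short exact sequences `0 → K → P → M → 0` with `P = F_0`, where `K` has a flat
resolution of length `n - 1`. -/
def HasFlatResolution : ℕ → RightMod C → Prop
  | 0, M => IsFlat M
  | n + 1, M => ∃ (K P : RightMod C) (i : K ⟶ P) (p : P ⟶ M) (w : i ≫ p = 0),
      (ShortComplex.mk i p w).ShortExact ∧ IsFlat P ∧ HasFlatResolution n K

/-- The flat dimension: the least length of a flat resolution, `⊤` if there is none of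
finite length. -/
noncomputable def flatDimension (M : RightMod C) : ℕ∞ :=
  sInf {d : ℕ∞ | ∃ n : ℕ, d = n ∧ HasFlatResolution n M}

end Tensor

/-! ### Bredon dimensions -/

/-- The Bredon cohomological dimension: the projective dimension of the trivial module. -/
noncomputable def cd (G : Type u) [Group G] (F : Set (Subgroup G)) : WithBot ℕ∞ :=
  projectiveDimension (trivialMod (OrbitCat F))

/-- The Bredon homological dimension: the flat dimension of the trivial module. -/
noncomputable def hd (G : Type u) [Group G] (F : Set (Subgroup G)) : ℕ∞ :=
  flatDimension (trivialMod (OrbitCat F))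

end BredonTheory

/-! Let `K` be one of the subgroups `G_λ`. As `F_λ ⊆ F`, the assignment `K/L ↦ G/L` is a functor
`orbitInduction` between orbit categories, and the constant module ℤ is compared along it.

Restriction sends ℤ to ℤ and preserves flat modules, so `hd K ≤ hd G`. Induction is exact, preserves
flat and projective modules, and sends ℤ to the free module `ℤ[?, G/K]`, whose flat and projective
dimensions are therefore at most those of ℤ over `K`. Both facts rest on a Kan extension being exact
because it is pointwise a direct sum: the comma categories split into components with a terminal
object. The components are indexed by the `K`-orbits on `G/H` for restriction
(`hasDiscreteFinalFamilies_orbitInduction`) and by the `G`-maps `G/H → G/K` for induction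
(`cosetUniversalSection`).

Since every member of `F` lies in some `G_λ` and the `G_λ` exhaust `G`, the modules `ℤ[?, G/G_λ]`
have colimit ℤ (`isColimitCosetModulesCocone`). Filtered colimits do not raise flat dimension, which
gives (i). For countable `Λ` there is a cofinal sequence, and its telescope costs one projective
dimension, which gives (ii).

Flatness is handled by duality: with `M^* = Hom(M, ℚ/ℤ)`, flat resolutions of `M` of length `n`
exist exactly when `M^*` has injective dimension at most `n` (`hasFlatResolution_iff`). -/

namespace BredonTheory

noncomputable section

/-! ### The tensor-hom adjunction -/

section TensorHom

variable {C : Type u} [SmallCategory C]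

open Classical in
/-- The class of the elementary tensor `m ⊗ n` with `m ∈ M(c)` and `n ∈ N(c)`. -/
def tensorMk (M : RightMod C) (N : LeftMod C) (c : C) (m : M.obj (op c)) (n : N.obj c) :
    (tensorFunctor N).obj M :=
  (QuotientAddGroup.mk (DirectSum.of (fun c : C => (M.obj (op c)) ⊗[ℤ] (N.obj c)) c
    (m ⊗ₜ[ℤ] n)) : PreTensor M N ⧸ tensorRel M N)

theorem tensorMk_add_left {M : RightMod C} {N : LeftMod C} {c : C} (m m' : M.obj (op c))
    (n : N.obj c) : tensorMk M N c (m + m') n = tensorMk M N c m n + tensorMk M N c m' n := by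
  simp only [tensorMk, TensorProduct.add_tmul, map_add]
  rfl

theorem tensorMk_add_right {M : RightMod C} {N : LeftMod C} {c : C} (m : M.obj (op c))
    (n n' : N.obj c) : tensorMk M N c m (n + n') = tensorMk M N c m n + tensorMk M N c m n' := by
  simp only [tensorMk, TensorProduct.tmul_add, map_add]
  rfl

theorem tensorMk_balanced {M : RightMod C} {N : LeftMod C} {c d : C} (φ : c ⟶ d)
    (m : M.obj (op d)) (n : N.obj c) :
    tensorMk M N c ((M.map φ.op).hom m) n = tensorMk M N d m ((N.map φ).hom n) := by
  exact QuotientAddGroup.eq_iff_sub_mem.2 (AddSubgroup.subset_closure ⟨c, d, φ, m, n, rfl⟩)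

theorem tensorFunctor_map_tensorMk {M M' : RightMod C} (f : M ⟶ M') (N : LeftMod C) {c : C}
    (m : M.obj (op c)) (n : N.obj c) :
    ((tensorFunctor N).map f).hom (tensorMk M N c m n)
      = tensorMk M' N c ((f.app (op c)).hom m) n := by
  classical
  change QuotientAddGroup.mk (preTensorMap f N _) = _
  rw [preTensorMap, DirectSum.map_of]
  rfl

theorem tensor_hom_ext {M : RightMod C} {N : LeftMod C} {A : AddCommGrpCat.{u}}
    {f g : (tensorFunctor N).obj M ⟶ A}
    (h : ∀ c m n, f.hom (tensorMk M N c m n) = g.hom (tensorMk M N c m n)) : f = g := by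
  classical
  refine AddCommGrpCat.hom_ext (QuotientAddGroup.addMonoidHom_ext _
    (DirectSum.addHom_ext' fun c => AddMonoidHom.ext fun y => ?_))
  induction y using TensorProduct.induction_on with
  | zero => simp
  | add a b ha hb => rw [map_add, map_add, ha, hb]
  | tmul a b => exact h c a b

/-- A family of balanced biadditive maps `M(c) × N(c) → A` induces a map on `M ⊗ N`. -/
def tensorLift {M : RightMod C} {N : LeftMod C} {A : AddCommGrpCat.{u}}
    (b : ∀ c : C, M.obj (op c) →+ N.obj c →+ A)
    (hb : ∀ ⦃c d : C⦄ (φ : c ⟶ d) (m : M.obj (op d)) (n : N.obj c),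
      b c ((M.map φ.op).hom m) n = b d m ((N.map φ).hom n)) :
    (tensorFunctor N).obj M ⟶ A :=
  AddCommGrpCat.ofHom (QuotientAddGroup.lift (tensorRel M N)
    (by
      classical
      exact DirectSum.toAddMonoid fun c => TensorProduct.liftAddHom (b c) (by simp))
    (by
      classical
      rw [tensorRel, AddSubgroup.closure_le]
      rintro _ ⟨c, d, φ, m, n, rfl⟩
      simp [hb]))

theorem tensorLift_tensorMk {M : RightMod C} {N : LeftMod C} {A : AddCommGrpCat.{u}}
    (b : ∀ c : C, M.obj (op c) →+ N.obj c →+ A)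
    (hb : ∀ ⦃c d : C⦄ (φ : c ⟶ d) (m : M.obj (op d)) (n : N.obj c),
      b c ((M.map φ.op).hom m) n = b d m ((N.map φ).hom n)) (c : C) (m : M.obj (op c))
    (n : N.obj c) : (tensorLift b hb).hom (tensorMk M N c m n) = b c m n := by
  classical
  exact DirectSum.toAddMonoid_of (fun c => TensorProduct.liftAddHom (b c) (by simp)) c
    (m ⊗ₜ[ℤ] n)

/-- The map induced by a morphism of left modules. -/
def tensorMapRight {N N' : LeftMod C} (g : N ⟶ N') : tensorFunctor N ⟶ tensorFunctor N' where
  app M := tensorLift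
    (fun c => AddMonoidHom.mk' (fun m => AddMonoidHom.mk'
      (fun n => tensorMk M N' c m ((g.app c).hom n))
      fun n n' => by rw [map_add, tensorMk_add_right])
      fun m m' => by ext n; exact tensorMk_add_left _ _ _)
    fun c d φ m n => by
      have h : (N'.map φ).hom ((g.app c).hom n) = (g.app d).hom ((N.map φ).hom n) :=
        congrArg (fun k => k.hom n) (g.naturality φ).symm
      change tensorMk M N' c ((M.map φ.op).hom m) ((g.app c).hom n)
        = tensorMk M N' d m ((g.app d).hom ((N.map φ).hom n))
      rw [tensorMk_balanced, h]
  naturality M M' f := tensor_hom_ext fun c m n => by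
    rw [AddCommGrpCat.hom_comp, AddCommGrpCat.hom_comp, AddMonoidHom.comp_apply,
      AddMonoidHom.comp_apply, tensorFunctor_map_tensorMk, tensorLift_tensorMk,
      tensorLift_tensorMk]
    exact (tensorFunctor_map_tensorMk f N' m _).symm

theorem tensorMapRight_tensorMk {N N' : LeftMod C} (g : N ⟶ N') (M : RightMod C) (c : C)
    (m : M.obj (op c)) (n : N.obj c) :
    ((tensorMapRight g).app M).hom (tensorMk M N c m n) = tensorMk M N' c m ((g.app c).hom n) := by
  dsimp only [tensorMapRight]
  rw [tensorLift_tensorMk]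
  rfl

/-- The right module `c ↦ Hom(N(c), A)`, functorially in `A`. -/
def homFunctor (N : LeftMod C) : AddCommGrpCat.{u} ⥤ RightMod C :=
  preadditiveYoneda ⋙ (Functor.whiskeringLeft _ _ _).obj N.op

/-- The biadditive maps `M(c) × N(c) → A` given by a map `M ⟶ Hom(N, A)`. -/
def pairing {M : RightMod C} {N : LeftMod C} {A : AddCommGrpCat.{u}}
    (φ : M ⟶ (homFunctor N).obj A) (c : C) : M.obj (op c) →+ N.obj c →+ A :=
  AddMonoidHom.mk' (fun m => ((φ.app (op c)).hom m : N.obj c ⟶ A).hom)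
    fun m m' => by rw [map_add]; rfl

theorem pairing_balanced {M : RightMod C} {N : LeftMod C} {A : AddCommGrpCat.{u}}
    (φ : M ⟶ (homFunctor N).obj A) ⦃c d : C⦄ (f : c ⟶ d) (m : M.obj (op d)) (n : N.obj c) :
    pairing φ c ((M.map f.op).hom m) n = pairing φ d m ((N.map f).hom n) :=
  congrArg (fun k : N.obj c ⟶ A => k.hom n) (congrArg (fun k => k.hom m) (φ.naturality f.op))

/-- Maps `M ⊗ N ⟶ A` are maps `M ⟶ Hom(N, A)`. -/
def tensorHomEquiv (M : RightMod C) (N : LeftMod C) (A : AddCommGrpCat.{u}) :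
    ((tensorFunctor N).obj M ⟶ A) ≃ (M ⟶ (homFunctor N).obj A) where
  toFun f :=
    { app c := AddCommGrpCat.ofHom (AddMonoidHom.mk'
        (fun m => (AddCommGrpCat.ofHom (AddMonoidHom.mk'
          (fun n => f.hom (tensorMk M N c.unop m n))
          fun n n' => by rw [tensorMk_add_right, map_add]) : N.obj c.unop ⟶ A))
        fun m m' => by
          refine AddCommGrpCat.hom_ext (AddMonoidHom.ext fun n => ?_)
          change f.hom _ = f.hom _ + f.hom _
          rw [tensorMk_add_left, map_add])
      naturality c d φ := by
        refine AddCommGrpCat.hom_ext (AddMonoidHom.ext fun m =>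
          AddCommGrpCat.hom_ext (AddMonoidHom.ext fun n => ?_))
        exact congrArg f.hom (tensorMk_balanced φ.unop m n) }
  invFun φ := tensorLift (pairing φ) (pairing_balanced φ)
  left_inv f := tensor_hom_ext fun c m n => tensorLift_tensorMk _ _ c m n
  right_inv φ := by
    refine NatTrans.ext (funext fun c => AddCommGrpCat.hom_ext (AddMonoidHom.ext fun m =>
      AddCommGrpCat.hom_ext (AddMonoidHom.ext fun n => ?_)))
    exact tensorLift_tensorMk (pairing φ) (pairing_balanced φ) c.unop m n

/-- The tensor product with `N` is left adjoint to `A ↦ Hom(N, A)`. -/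
def tensorAdjunction (N : LeftMod C) : tensorFunctor N ⊣ homFunctor N :=
  Adjunction.mkOfHomEquiv
    { homEquiv := fun M A => tensorHomEquiv M N A
      homEquiv_naturality_left_symm := fun f g => tensor_hom_ext fun c m n => by
        rw [AddCommGrpCat.hom_comp, AddMonoidHom.comp_apply, tensorFunctor_map_tensorMk]
        refine (tensorLift_tensorMk (pairing (f ≫ g)) (pairing_balanced _) c m n).trans ?_
        exact (tensorLift_tensorMk (pairing g) (pairing_balanced g) c
          ((f.app (op c)).hom m) n).symm
      homEquiv_naturality_right := fun f g => rfl }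

end TensorHom

/-! ### Character modules -/

section Character

/-- The group `ℚ / ℤ`. -/
def charGroup : AddCommGrpCat.{u} := AddCommGrpCat.of (ULift.{u} (AddCircle (1 : ℚ)))

instance : Injective charGroup.{u} :=
  AddCommGrpCat.injective_of_divisible (ULift.{u} (AddCircle (1 : ℚ)))

/-- `Hom(-, ℚ/ℤ)` is left exact, and ℚ/ℤ is injective because it is divisible. Exactness is what
makes character modules of short exact sequences short exact. -/
instance : Limits.PreservesFiniteColimits (preadditiveYoneda.obj charGroup.{u}) := by
  have := (Injective.injective_iff_preservesEpimorphisms_preadditiveYoneda_obj charGroup.{u}).1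
    inferInstance
  have := Functor.preservesHomology_of_preservesEpis_and_kernels
    (preadditiveYoneda.obj charGroup.{u})
  exact Functor.preservesFiniteColimits_of_preservesHomology _

theorem exists_charGroup_ne_zero {A : AddCommGrpCat.{u}} {a : A} (ha : a ≠ 0) :
    ∃ f : A ⟶ charGroup, f.hom a ≠ 0 := by
  obtain ⟨f, hf⟩ := CharacterModule.exists_character_apply_ne_zero_of_ne_zero ha
  refine ⟨AddCommGrpCat.ofHom (AddEquiv.ulift.symm.toAddMonoidHom.comp f), fun h => hf ?_⟩
  exact congrArg ULift.down h

variable {C : Type u} [SmallCategory C]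

/-- The character module of a left module. -/
abbrev leftDual (N : LeftMod C) : RightMod C := N.op ⋙ preadditiveYoneda.obj charGroup

/-- The character module of a right module. -/
abbrev rightDual (M : RightMod C) : LeftMod C := M.rightOp ⋙ preadditiveYoneda.obj charGroup

/-- The map on character modules induced by a morphism of left modules. -/
abbrev leftDualMap {N N' : LeftMod C} (g : N ⟶ N') : leftDual N' ⟶ leftDual N :=
  Functor.whiskerRight (NatTrans.op g) _

/-- The map on character modules induced by a morphism of right modules. -/
abbrev rightDualMap {M M' : RightMod C} (f : M ⟶ M') : rightDual M' ⟶ rightDual M :=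
  Functor.whiskerRight (NatTrans.rightOp f) _

/-- Maps `M ⟶ N^*` and maps `N ⟶ M^*` are both pairings of `M` and `N`. -/
def dualSwap (M : RightMod C) (N : LeftMod C) : (M ⟶ leftDual N) ≃ (N ⟶ rightDual M) where
  toFun φ :=
    { app c := AddCommGrpCat.ofHom (AddMonoidHom.mk'
        (fun n => (AddCommGrpCat.ofHom (AddMonoidHom.mk'
          (fun m => ((φ.app (op c)).hom m : N.obj c ⟶ charGroup).hom n)
          fun m m' => by rw [map_add]; rfl) : M.obj (op c) ⟶ charGroup))
        fun n n' => by
          refine AddCommGrpCat.hom_ext (AddMonoidHom.ext fun m => ?_)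
          exact map_add ((φ.app (op c)).hom m : N.obj c ⟶ charGroup).hom _ _)
      naturality c d f := by
        refine AddCommGrpCat.hom_ext (AddMonoidHom.ext fun n =>
          AddCommGrpCat.hom_ext (AddMonoidHom.ext fun m => ?_))
        exact (congrArg (fun k : N.obj c ⟶ charGroup => k.hom n)
          (congrArg (fun k => k.hom m) (φ.naturality f.op))).symm }
  invFun ψ :=
    { app c := AddCommGrpCat.ofHom (AddMonoidHom.mk'
        (fun m => (AddCommGrpCat.ofHom (AddMonoidHom.mk'
          (fun n => ((ψ.app c.unop).hom n : M.obj c ⟶ charGroup).hom m)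
          fun n n' => by rw [map_add]; rfl) : N.obj c.unop ⟶ charGroup))
        fun m m' => by
          refine AddCommGrpCat.hom_ext (AddMonoidHom.ext fun n => ?_)
          exact map_add ((ψ.app c.unop).hom n : M.obj c ⟶ charGroup).hom _ _)
      naturality c d f := by
        refine AddCommGrpCat.hom_ext (AddMonoidHom.ext fun m =>
          AddCommGrpCat.hom_ext (AddMonoidHom.ext fun n => ?_))
        exact (congrArg (fun k : M.obj c ⟶ charGroup => k.hom m)
          (congrArg (fun k => k.hom n) (ψ.naturality f.unop))).symm }
  left_inv φ := rfl
  right_inv ψ := rfl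

theorem dualSwap_comp {M M' : RightMod C} {N : LeftMod C} (f : M ⟶ M') (φ : M' ⟶ leftDual N) :
    dualSwap M N (f ≫ φ) = dualSwap M' N φ ≫ rightDualMap f := rfl

theorem dualSwap_comp_leftDualMap {M : RightMod C} {N N' : LeftMod C} (g : N ⟶ N')
    (φ : M ⟶ leftDual N') : dualSwap M N (φ ≫ leftDualMap g) = g ≫ dualSwap M N' φ := rfl

/-- Characters of `M ⊗ N` are maps `N ⟶ M^*`. -/
def tensorDualEquiv (M : RightMod C) (N : LeftMod C) :
    ((tensorFunctor N).obj M ⟶ charGroup) ≃ (N ⟶ rightDual M) :=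
  (tensorHomEquiv M N charGroup).trans (dualSwap M N)

theorem tensorDualEquiv_tensorMapRight {M : RightMod C} {N N' : LeftMod C} (g : N ⟶ N')
    (f : (tensorFunctor N').obj M ⟶ charGroup) :
    tensorDualEquiv M N ((tensorMapRight g).app M ≫ f) = g ≫ tensorDualEquiv M N' f := by
  refine NatTrans.ext (funext fun c => AddCommGrpCat.hom_ext (AddMonoidHom.ext fun n =>
    AddCommGrpCat.hom_ext (AddMonoidHom.ext fun m => ?_)))
  exact congrArg f.hom (tensorMapRight_tensorMk g M c m n)

theorem shortExact_of_evaluation {K : Type*} [Category K] {A : Type*} [Category A] [Abelian A]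
    {S : ShortComplex (K ⥤ A)} (h : ∀ k, (S.map ((evaluation K A).obj k)).ShortExact) :
    S.ShortExact where
  exact := by
    rw [ShortComplex.exact_iff_isZero_homology, Functor.isZero_iff]
    intro k
    exact ((ShortComplex.exact_iff_isZero_homology _).1 (h k).exact).of_iso
      (S.mapHomologyIso ((evaluation K A).obj k)).symm
  mono_f := by
    have := fun k => (h k).mono_f
    rw [NatTrans.mono_iff_mono_app]
    exact this
  epi_g := by
    have := fun k => (h k).epi_g
    rw [NatTrans.epi_iff_epi_app]
    exact this

/-- The short complex of character modules. -/
def dualComplex (S : ShortComplex (RightMod C)) : ShortComplex (LeftMod C) where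
  f := rightDualMap S.g
  g := rightDualMap S.f
  zero := by
    rw [← Functor.whiskerRight_comp, ← NatTrans.rightOp_comp, S.zero]
    refine NatTrans.ext (funext fun c => AddCommGrpCat.hom_ext (AddMonoidHom.ext fun m =>
      AddCommGrpCat.hom_ext (AddMonoidHom.ext fun _ => ?_)))
    exact map_zero (m : S.X₃.obj (op c) ⟶ charGroup).hom

theorem shortExact_dualComplex {S : ShortComplex (RightMod C)} (hS : S.ShortExact) :
    (dualComplex S).ShortExact :=
  shortExact_of_evaluation fun c =>
    (hS.map_of_exact ((evaluation _ _).obj (op c))).op.map_of_exact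
      (preadditiveYoneda.obj charGroup)

instance epi_leftDualMap {N N' : LeftMod C} (g : N ⟶ N') [Mono g] : Epi (leftDualMap g) := by
  rw [NatTrans.epi_iff_epi_app]
  intro c
  exact inferInstanceAs (Epi ((preadditiveYoneda.obj charGroup).map (g.app c.unop).op))

end Character

/-! ### Shifting the degree in `Ext` -/

section Ext

universe v w w'

variable {A : Type v} [Category.{w} A] [Abelian A]

theorem exists_shortExact_projective [EnoughProjectives A] (X : A) :
    ∃ S : ShortComplex A, S.ShortExact ∧ Projective S.X₂ ∧ S.X₃ = X :=
  ⟨ShortComplex.mk _ _ (Limits.kernel.condition (Projective.π X)),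
    { exact := ShortComplex.exact_kernel _ }, by dsimp; infer_instance, rfl⟩

variable [HasExt.{w'} A]

/-- The middle term is projective, so `Ext¹(X₃, Y)` is the cokernel of `Hom(X₂, Y) → Hom(X₁, Y)`.
Dimension shifting reduces higher degrees to this extension problem. -/
theorem subsingleton_ext_one_iff {S : ShortComplex A} (hS : S.ShortExact) [Projective S.X₂]
    (Y : A) :
    Subsingleton (Abelian.Ext S.X₃ Y 1) ↔ ∀ φ : S.X₁ ⟶ Y, ∃ ψ : S.X₂ ⟶ Y, S.f ≫ ψ = φ := by
  constructor
  · intro h φ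
    obtain ⟨x, hx⟩ := Abelian.Ext.contravariant_sequence_exact₁ hS Y (Abelian.Ext.mk₀ φ)
      (add_zero 1) (Subsingleton.elim _ _)
    obtain ⟨ψ, rfl⟩ := (Abelian.Ext.mk₀_bijective _ _).2 x
    rw [Abelian.Ext.mk₀_comp_mk₀] at hx
    exact ⟨ψ, (Abelian.Ext.mk₀_bijective _ _).1 hx⟩
  · refine fun h => subsingleton_of_forall_eq 0 fun e => ?_
    obtain ⟨x, rfl⟩ := Abelian.Ext.contravariant_sequence_exact₃ hS Y e
      (Abelian.Ext.eq_zero_of_projective _) (add_zero 1)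
    obtain ⟨φ, rfl⟩ := (Abelian.Ext.mk₀_bijective _ _).2 x
    obtain ⟨ψ, rfl⟩ := h φ
    rw [← Abelian.Ext.mk₀_comp_mk₀, hS.extClass_comp_assoc]

theorem subsingleton_ext_add_two_iff {S : ShortComplex A} (hS : S.ShortExact) [Projective S.X₂]
    (Y : A) (k : ℕ) :
    Subsingleton (Abelian.Ext S.X₃ Y (k + 2)) ↔ Subsingleton (Abelian.Ext S.X₁ Y (k + 1)) := by
  constructor
  · refine fun h => subsingleton_of_forall_eq 0 fun e => ?_
    obtain ⟨x, rfl⟩ := Abelian.Ext.contravariant_sequence_exact₁ hS Y e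
      (show 1 + (k + 1) = k + 2 by ring) (Subsingleton.elim _ _)
    rw [Abelian.Ext.eq_zero_of_projective x, Abelian.Ext.comp_zero]
  · refine fun h => subsingleton_of_forall_eq 0 fun e => ?_
    obtain ⟨x, rfl⟩ := Abelian.Ext.contravariant_sequence_exact₃ hS Y e
      (Abelian.Ext.eq_zero_of_projective _) (show 1 + (k + 1) = k + 2 by ring)
    rw [Subsingleton.elim x 0, Abelian.Ext.comp_zero]

end Ext

/-! ### Flatness and character modules -/

section Flat

variable {C : Type u} [SmallCategory C]

instance enoughProjectives_leftMod : EnoughProjectives (LeftMod C) :=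
  ((opOpEquivalence C).congrLeft (E := AddCommGrpCat.{u})).enoughProjectives_iff.1
    (enoughProjectives_rightMod Cᵒᵖ)

/-- A cycle outside the image of `S.f` is detected by a character of `X₂ / im f`; if that character
factors through `S.g`, it must vanish on the cycle. -/
theorem exact_iff_charGroup (S : ShortComplex AddCommGrpCat.{u}) :
    S.Exact ↔ ∀ g : S.X₂ ⟶ charGroup, S.f ≫ g = 0 → ∃ h : S.X₃ ⟶ charGroup, S.g ≫ h = g := by
  constructor
  · exact fun hS g hg => ⟨hS.descToInjective g hg, hS.comp_descToInjective g hg⟩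
  · intro h
    rw [ShortComplex.ab_exact_iff]
    intro x hx
    by_contra hx'
    have hne : (QuotientAddGroup.mk x : S.X₂ ⧸ S.f.hom.range) ≠ 0 := fun h0 =>
      hx' ((QuotientAddGroup.eq_zero_iff x).1 h0)
    obtain ⟨f, hf⟩ := exists_charGroup_ne_zero
      (A := AddCommGrpCat.of (S.X₂ ⧸ S.f.hom.range)) hne
    obtain ⟨k, hk⟩ := h (AddCommGrpCat.ofHom (QuotientAddGroup.mk' S.f.hom.range) ≫ f) (by
      ext y
      have : (QuotientAddGroup.mk (S.f.hom y) : S.X₂ ⧸ S.f.hom.range) = 0 :=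
        (QuotientAddGroup.eq_zero_iff _).2 ⟨y, rfl⟩
      exact (congrArg f.hom this).trans (map_zero _))
    apply hf
    have := congrArg (fun q => q.hom x) hk
    refine this.symm.trans ?_
    exact (congrArg k.hom hx).trans (map_zero _)

theorem mono_iff_charGroup {A B : AddCommGrpCat.{u}} (f : A ⟶ B) :
    Mono f ↔ ∀ g : A ⟶ charGroup, ∃ h : B ⟶ charGroup, f ≫ h = g := by
  constructor
  · exact fun _ g => ⟨Injective.factorThru g f, Injective.comp_factorThru g f⟩
  · intro h
    rw [AddCommGrpCat.mono_iff_injective, injective_iff_map_eq_zero]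
    intro a ha
    by_contra hne
    obtain ⟨g, hg⟩ := exists_charGroup_ne_zero hne
    obtain ⟨k, rfl⟩ := h g
    exact hg ((congrArg k.hom ha).trans (map_zero _))

/-- Exactness of `P ⊗ N`, for `P` a projective resolution of `M`, can be tested on characters. The
tensor-hom adjunction turns these into `Hom(P, N^*)`, which computes `Ext(M, N^*)`. -/
theorem isZero_tor_succ_iff [HasExt.{u} (RightMod C)] (M : RightMod C) (N : LeftMod C) (k : ℕ) :
    Limits.IsZero (tor (k + 1) M N) ↔
      Subsingleton (Abelian.Ext M ((homFunctor N).obj charGroup) (k + 1)) := by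
  let P := projectiveResolution M
  have h1 : Limits.IsZero (tor (k + 1) M N) ↔
      (ShortComplex.mk ((tensorFunctor N).map (P.complex.d (k + 2) (k + 1)))
        ((tensorFunctor N).map (P.complex.d (k + 1) k)) (by
          rw [← Functor.map_comp, P.complex.d_comp_d, Functor.map_zero])).Exact := by
    refine (Iso.isZero_iff (P.isoLeftDerivedObj (tensorFunctor N) (k + 1))).trans ?_
    erw [← HomologicalComplex.exactAt_iff_isZero_homology]
    exact HomologicalComplex.exactAt_iff' _ (k + 2) (k + 1) k (by simp) (by simp)
  rw [h1, exact_iff_charGroup]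
  let e := fun i => (tensorAdjunction N).homEquiv (P.complex.X i) charGroup
  have he : ∀ i j (f : (tensorFunctor N).obj (P.complex.X j) ⟶ charGroup),
      e i ((tensorFunctor N).map (P.complex.d i j) ≫ f) = P.complex.d i j ≫ e j f :=
    fun i j f => Adjunction.homEquiv_naturality_left _ _ _
  have he0 : ∀ i (f : (tensorFunctor N).obj (P.complex.X i) ⟶ charGroup), e i f = 0 ↔ f = 0 := by
    have h0 : ∀ i, e i 0 = 0 := fun i => (tensorAdjunction N).homAddEquiv_zero _ _
    exact fun i f => ⟨fun h => (e i).injective (h.trans (h0 i).symm), fun h => h ▸ h0 i⟩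
  constructor
  · refine fun h => subsingleton_of_forall_eq 0 fun x => ?_
    obtain ⟨f, hf, rfl⟩ := P.extMk_surjective x (k + 2) rfl
    obtain ⟨f, rfl⟩ := (e (k + 1)).surjective f
    rw [P.extMk_eq_zero_iff _ _ _ _ k rfl]
    obtain ⟨g, hg⟩ := h f ((he0 _ _).1 ((he _ _ _).trans hf))
    exact ⟨e k g, (he _ _ _).symm.trans (congrArg _ hg)⟩
  · intro h f hf
    obtain ⟨g, hg⟩ := (P.extMk_eq_zero_iff (e (k + 1) f) (k + 2) rfl
      ((he _ _ _).symm.trans ((he0 _ _).2 hf)) k rfl).1 (Subsingleton.elim _ _)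
    obtain ⟨g, rfl⟩ := (e k).surjective g
    exact ⟨g, (e (k + 1)).injective ((he _ _ _).trans hg)⟩

/-- By `dualSwap`, extending `N ⟶ P^*` along a monomorphism is lifting `P ⟶ N^*` along the dual
epimorphism. -/
instance injective_rightDual (P : RightMod C) [Projective P] : Injective (rightDual P) where
  factors {N N'} g f _ := by
    refine ⟨dualSwap P N' (Projective.factorThru ((dualSwap P N).symm g) (leftDualMap f)), ?_⟩
    rw [← dualSwap_comp_leftDualMap, Projective.factorThru_comp, Equiv.apply_symm_apply]

/-- If `X₃^*` is injective, the dual sequence splits, and the section of `X₂^* ⟶ X₁^*` solves every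
extension problem. Conversely, the universal case `N = X₁^*` yields such a section, making `X₃^*` a
retract of the injective `X₂^*`. -/
theorem injective_rightDual_X₃_iff {S : ShortComplex (RightMod C)} (hS : S.ShortExact)
    [Projective S.X₂] : Injective (rightDual S.X₃) ↔
      ∀ (N : LeftMod C) (φ : S.X₁ ⟶ leftDual N), ∃ ψ : S.X₂ ⟶ leftDual N, S.f ≫ ψ = φ := by
  have hS' := shortExact_dualComplex hS
  constructor
  · intro h N φ
    have : Injective (dualComplex S).X₁ := h
    obtain ⟨s, hs⟩ : ∃ s : rightDual S.X₁ ⟶ rightDual S.X₂, s ≫ rightDualMap S.f = 𝟙 _ :=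
      ⟨hS'.splittingOfInjective.s, hS'.splittingOfInjective.s_g⟩
    refine ⟨(dualSwap _ _).symm (dualSwap _ _ φ ≫ s), (dualSwap _ _).injective ?_⟩
    rw [dualSwap_comp, Equiv.apply_symm_apply, Category.assoc, hs, Category.comp_id]
  · intro h
    obtain ⟨ψ, hψ⟩ := h (rightDual S.X₁) ((dualSwap _ _).symm (𝟙 _))
    let s := ShortComplex.Splitting.ofExactOfSection (dualComplex S) hS'.exact (dualSwap _ _ ψ)
      (by
        refine (dualSwap_comp S.f ψ).symm.trans ?_
        rw [hψ, Equiv.apply_symm_apply]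
        rfl) hS'.mono_f
    have : Injective (dualComplex S).X₂ := injective_rightDual S.X₂
    exact Retract.injective { i := (dualComplex S).f, r := s.r, retract := s.f_r }

theorem injective_rightDual_X₁ {S : ShortComplex (RightMod C)} (hS : S.ShortExact)
    [Projective S.X₂] [Injective (rightDual S.X₃)] : Injective (rightDual S.X₁) := by
  rw [injective_iff_hasInjectiveDimensionLT_one]
  have : Injective (dualComplex S).X₂ := injective_rightDual S.X₂
  have : Injective (dualComplex S).X₁ := ‹Injective (rightDual S.X₃)›
  exact (shortExact_dualComplex hS).hasInjectiveDimensionLT_X₃ 1 inferInstance inferInstance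

/-- Lambek's criterion. Vanishing of `Tor_1` already gives injectivity; conversely, injectivity of
the dual passes to the kernel of a projective presentation, so dimension shifting reaches all
degrees. -/
theorem isFlat_iff_injective_rightDual (M : RightMod C) :
    IsFlat M ↔ Injective (rightDual M) := by
  have := hasExt_of_enoughProjectives.{u} (RightMod C)
  constructor
  · intro h
    obtain ⟨S, hS, _, rfl⟩ := exists_shortExact_projective M
    rw [injective_rightDual_X₃_iff hS]
    intro N
    exact (subsingleton_ext_one_iff hS (leftDual N)).1
      ((isZero_tor_succ_iff _ N 0).1 (h N 1 one_pos))
  · intro h N i hi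
    obtain ⟨k, rfl⟩ := Nat.exists_eq_succ_of_ne_zero hi.ne'
    refine (isZero_tor_succ_iff M N k).2 ?_
    change Subsingleton (Abelian.Ext M (leftDual N) (k + 1))
    clear hi
    induction k generalizing M with
    | zero =>
      obtain ⟨S, hS, _, rfl⟩ := exists_shortExact_projective M
      exact (subsingleton_ext_one_iff hS _).2 ((injective_rightDual_X₃_iff hS).1 h N)
    | succ k ih =>
      obtain ⟨S, hS, _, rfl⟩ := exists_shortExact_projective M
      exact (subsingleton_ext_add_two_iff hS _ k).2 (ih _ (injective_rightDual_X₁ hS))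

/-- Dualising `0 → K → P → M → 0` gives one step of an injective coresolution of `M^*`. In the
converse any projective presentation serves, so the existence of a resolution does not depend on the
choices made. -/
theorem hasFlatResolution_iff (n : ℕ) (M : RightMod C) :
    HasFlatResolution n M ↔ HasInjectiveDimensionLT (rightDual M) (n + 1) := by
  induction n generalizing M with
  | zero =>
    exact (isFlat_iff_injective_rightDual M).trans injective_iff_hasInjectiveDimensionLT_one
  | succ n ih =>
    constructor
    · rintro ⟨K, P, i, p, w, hS, hP, hK⟩
      have : Injective (rightDual P) := (isFlat_iff_injective_rightDual P).1 hP
      exact (shortExact_dualComplex hS).hasInjectiveDimensionLT_X₁ (n + 1) ((ih K).1 hK)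
        (inferInstanceAs (HasInjectiveDimensionLT (rightDual P) _))
    · intro h
      obtain ⟨S, hS, _, rfl⟩ := exists_shortExact_projective M
      refine ⟨S.X₁, S.X₂, S.f, S.g, S.zero, hS,
        (isFlat_iff_injective_rightDual _).2 inferInstance, (ih _).2 ?_⟩
      exact (shortExact_dualComplex hS).hasInjectiveDimensionLT_X₃ (n + 1)
        (inferInstanceAs (HasInjectiveDimensionLT (rightDual S.X₂) _)) h

/-- Isomorphic modules have isomorphic character modules. -/
def rightDualIso {M M' : RightMod C} (e : M ≅ M') : rightDual M ≅ rightDual M' where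
  hom := rightDualMap e.inv
  inv := rightDualMap e.hom
  hom_inv_id := by
    rw [← Functor.whiskerRight_comp, ← NatTrans.rightOp_comp, e.hom_inv_id, NatTrans.rightOp_id,
      Functor.whiskerRight_id']
  inv_hom_id := by
    rw [← Functor.whiskerRight_comp, ← NatTrans.rightOp_comp, e.inv_hom_id, NatTrans.rightOp_id,
      Functor.whiskerRight_id']

theorem HasFlatResolution.of_iso {M M' : RightMod C} (e : M ≅ M') {n : ℕ}
    (h : HasFlatResolution n M) : HasFlatResolution n M' := by
  rw [hasFlatResolution_iff] at h ⊢
  exact hasInjectiveDimensionLT_of_iso (rightDualIso e) _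

theorem HasFlatResolution.mono {M : RightMod C} {m n : ℕ} (h : HasFlatResolution m M)
    (hmn : m ≤ n) : HasFlatResolution n M := by
  rw [hasFlatResolution_iff] at h ⊢
  exact hasInjectiveDimensionLT_of_ge _ (m + 1) _ (by omega)

theorem flatDimension_le_iff (M : RightMod C) (n : ℕ) :
    flatDimension M ≤ n ↔ HasFlatResolution n M := by
  constructor
  · intro h
    -- The strict bound `n + 1` allows a member of the set defining the infimum to be extracted.
    have hlt : flatDimension M < (n + 1 : ℕ) := h.trans_lt (by exact_mod_cast n.lt_succ_self)
    obtain ⟨_, ⟨m, rfl, hm⟩, hmn⟩ := sInf_lt_iff.1 hlt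
    exact hm.mono (Nat.lt_succ_iff.1 (by exact_mod_cast hmn))
  · exact fun h => sInf_le ⟨n, rfl, h⟩

/-! ### Flat resolutions of filtered colimits -/

/-- Both sides say that every character of `M ⊗ N` extends along `M ⊗ g`. The second form passes to
filtered colimits in `M`. -/
theorem forall_exists_rightDual_iff_mono (M : RightMod C) {N N' : LeftMod C} (g : N ⟶ N') :
    (∀ φ : N ⟶ rightDual M, ∃ ψ : N' ⟶ rightDual M, g ≫ ψ = φ)
      ↔ Mono ((tensorMapRight g).app M) := by
  rw [mono_iff_charGroup]
  constructor
  · intro h f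
    obtain ⟨ψ, hψ⟩ := h (tensorDualEquiv M N f)
    refine ⟨(tensorDualEquiv M N').symm ψ, (tensorDualEquiv M N).injective ?_⟩
    rw [tensorDualEquiv_tensorMapRight, Equiv.apply_symm_apply, hψ]
  · intro h φ
    obtain ⟨f, hf⟩ := h ((tensorDualEquiv M N).symm φ)
    refine ⟨tensorDualEquiv M N' f, ?_⟩
    rw [← tensorDualEquiv_tensorMapRight, hf, Equiv.apply_symm_apply]

section Colimit

variable {J : Type u} [SmallCategory J] [IsFiltered J] {D : J ⥤ RightMod C}
  {c : Limits.Cocone D} (hc : Limits.IsColimit c)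

include hc

/-- Tensoring is a left adjoint, hence commutes with the colimit, and filtered colimits of abelian
groups preserve monomorphisms. -/
theorem mono_tensorMapRight_of_isColimit {N N' : LeftMod C} (g : N ⟶ N')
    (h : ∀ j, Mono ((tensorMapRight g).app (D.obj j))) : Mono ((tensorMapRight g).app c.pt) := by
  have := (tensorAdjunction N).leftAdjoint_preservesColimits
  have := (tensorAdjunction N').leftAdjoint_preservesColimits
  have : Mono (Functor.whiskerLeft D (tensorMapRight g)) :=
    (NatTrans.mono_iff_mono_app _).2 h
  exact Limits.colim.map_mono' (Functor.whiskerLeft D (tensorMapRight g))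
    (Limits.isColimitOfPreserves (tensorFunctor N) hc)
    (Limits.isColimitOfPreserves (tensorFunctor N') hc) _
    fun j => (tensorMapRight g).naturality (c.ι.app j)

/-- The degree is shifted in the variable `N`, where a single projective presentation serves all `j`
and the colimit at once. -/
theorem subsingleton_ext_rightDual_of_isColimit [HasExt.{u} (LeftMod C)] (k : ℕ)
    (N : LeftMod C) (h : ∀ j, Subsingleton (Abelian.Ext N (rightDual (D.obj j)) (k + 1))) :
    Subsingleton (Abelian.Ext N (rightDual c.pt) (k + 1)) := by
  induction k generalizing N with
  | zero =>
    obtain ⟨S, hS, _, rfl⟩ := exists_shortExact_projective N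
    simp only [zero_add, subsingleton_ext_one_iff hS, forall_exists_rightDual_iff_mono] at h ⊢
    exact mono_tensorMapRight_of_isColimit hc S.f h
  | succ k ih =>
    obtain ⟨S, hS, _, rfl⟩ := exists_shortExact_projective N
    exact (subsingleton_ext_add_two_iff hS _ k).2
      (ih S.X₁ fun j => (subsingleton_ext_add_two_iff hS _ k).1 (h j))

theorem HasFlatResolution.of_isColimit {n : ℕ} (h : ∀ j, HasFlatResolution n (D.obj j)) :
    HasFlatResolution n c.pt := by
  have := hasExt_of_enoughProjectives.{u} (LeftMod C)
  rw [hasFlatResolution_iff]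
  refine hasInjectiveDimensionLT_of_enoughProjectives _ _ fun N =>
    subsingleton_ext_rightDual_of_isColimit hc n N fun j => ?_
  have := (hasFlatResolution_iff _ _).1 (h j)
  exact HasInjectiveDimensionLT.subsingleton _ (n + 1) _ le_rfl _

end Colimit

/-! ### Dimensions under exact functors -/

variable {C' : Type u} [SmallCategory C']

theorem HasFlatResolution.map (Φ : RightMod C ⥤ RightMod C') [Limits.PreservesFiniteLimits Φ]
    [Limits.PreservesFiniteColimits Φ] (hΦ : ∀ P, IsFlat P → IsFlat (Φ.obj P)) {n : ℕ}
    {M : RightMod C} (h : HasFlatResolution n M) : HasFlatResolution n (Φ.obj M) := by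
  have := Functor.preservesZeroMorphisms_of_preserves_terminal_object (F := Φ)
  induction n generalizing M with
  | zero => exact hΦ M h
  | succ n ih =>
    obtain ⟨K, P, i, p, w, hS, hP, hK⟩ := h
    exact ⟨Φ.obj K, Φ.obj P, Φ.map i, Φ.map p, ((ShortComplex.mk i p w).map Φ).zero,
      hS.map_of_exact Φ, hΦ P hP, ih hK⟩

end Flat

theorem hasProjectiveDimensionLT_map {A B : Type*} [Category A] [Category B] [Abelian A]
    [Abelian B] [EnoughProjectives A] (Φ : A ⥤ B) [Limits.PreservesFiniteLimits Φ]
    [Limits.PreservesFiniteColimits Φ] (hΦ : ∀ P, Projective P → Projective (Φ.obj P)) (n : ℕ)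
    (X : A) (h : HasProjectiveDimensionLT X n) : HasProjectiveDimensionLT (Φ.obj X) n := by
  have := Functor.preservesZeroMorphisms_of_preserves_terminal_object (F := Φ)
  induction n generalizing X with
  | zero =>
    rw [hasProjectiveDimensionLT_zero_iff_isZero] at h ⊢
    exact Φ.map_isZero h
  | succ n ih =>
    -- Dimension shifting along a projective presentation starts at the bound 2; the bound 1 means
    -- projectivity and is the hypothesis on `Φ`.
    cases n with
    | zero =>
      rw [← projective_iff_hasProjectiveDimensionLT_one] at h ⊢
      exact hΦ X h
    | succ n =>
      obtain ⟨S, hS, hP, rfl⟩ := exists_shortExact_projective X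
      have := hΦ _ hP
      exact ((hS.map_of_exact Φ).hasProjectiveDimensionLT_X₃_iff n this).2
        (ih _ ((hS.hasProjectiveDimensionLT_X₃_iff n hP).1 h))

/-! ### Exactness of left Kan extensions -/

section KanExtension

/-- If every object of `J` has a unique map to a unique member of a family of objects, then this
family is final. -/
theorem final_discrete_of_unique {J : Type u} [SmallCategory J] {S : Type u} (f : S → J)
    (h : ∀ j, ∃ p : Σ s, j ⟶ f s, ∀ q, q = p) : (Discrete.functor f).Final where
  out j := by
    obtain ⟨p, hp⟩ := h j
    have : Nonempty (StructuredArrow j (Discrete.functor f)) :=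
      ⟨StructuredArrow.mk (Y := Discrete.mk p.1) p.2⟩
    refine zigzag_isConnected fun X Y => ?_
    have key : ∀ X : StructuredArrow j (Discrete.functor f),
        X = StructuredArrow.mk (Y := Discrete.mk p.1) p.2 := by
      intro X
      rw [← hp ⟨X.right.as, X.hom⟩]
      exact StructuredArrow.eq_mk X
    rw [key X, key Y]

variable {D C : Type u} [SmallCategory D] [SmallCategory C] (F : D ⥤ C)

/-- Every category of arrows `F(-) ⟶ c` has a discrete final family. -/
def HasDiscreteFinalFamilies : Prop :=
  ∀ c, ∃ (S : Type u) (f : S → CostructuredArrow F c), ∀ j, ∃ p : Σ s, j ⟶ f s, ∀ q, q = p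

variable {F}

/-- The value of the Kan extension at `c` is a colimit over the arrows `F(-) ⟶ c`. A discrete final
family turns it into a direct sum, and direct sums are exact. -/
theorem preservesMonomorphisms_lan (h : HasDiscreteFinalFamilies F) :
    (F.lan : (D ⥤ AddCommGrpCat.{u}) ⥤ _).PreservesMonomorphisms where
  preserves {X Y} α _ := by
    rw [NatTrans.mono_iff_mono_app]
    intro c
    obtain ⟨S, f, hf⟩ := h c
    have := final_discrete_of_unique f hf
    have := hasExactColimitsOfShape_of_final AddCommGrpCat.{u} (Discrete.functor f)
    have : Mono (Functor.whiskerLeft (CostructuredArrow.proj F c) α) :=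
      (NatTrans.mono_iff_mono_app _).2 fun j => inferInstanceAs (Mono (α.app j.left))
    refine Limits.colim.map_mono' (Functor.whiskerLeft (CostructuredArrow.proj F c) α)
      (F.isPointwiseLeftKanExtensionLeftKanExtensionUnit X c)
      (F.isPointwiseLeftKanExtensionLeftKanExtensionUnit Y c) _ fun j => ?_
    have h1 := congrArg (fun β => β.app j.left) (F.lanUnit.naturality α)
    have h2 := (F.lan.map α).naturality j.hom
    change (F.lanUnit.app X).app j.left ≫ (F.lan.obj X).map j.hom ≫ (F.lan.map α).app c
      = α.app j.left ≫ (F.lanUnit.app Y).app j.left ≫ (F.lan.obj Y).map j.hom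
    rw [h2, ← Category.assoc, ← Category.assoc]
    exact congrArg (· ≫ _) h1.symm

theorem preservesFiniteLimits_lan (h : HasDiscreteFinalFamilies F) :
    Limits.PreservesFiniteLimits (F.lan : (D ⥤ AddCommGrpCat.{u}) ⥤ _) := by
  have := preservesMonomorphisms_lan h
  have := (F.lanAdjunction AddCommGrpCat.{u}).leftAdjoint_preservesColimits
  have := Functor.preservesZeroMorphisms_of_preserves_initial_object
    (F := (F.lan : (D ⥤ AddCommGrpCat.{u}) ⥤ _))
  have := Limits.preservesBinaryBiproducts_of_preservesBinaryCoproducts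
    (F.lan : (D ⥤ AddCommGrpCat.{u}) ⥤ _)
  have : (F.lan : (D ⥤ AddCommGrpCat.{u}) ⥤ _).Additive :=
    Functor.additive_of_preservesBinaryBiproducts _
  have := Functor.preservesHomology_of_preservesMonos_and_cokernels
    (F.lan : (D ⥤ AddCommGrpCat.{u}) ⥤ _)
  exact Functor.preservesFiniteLimits_of_preservesHomology _

/-- Restriction is right adjoint to a functor that preserves monomorphisms. -/
theorem injective_comp (h : HasDiscreteFinalFamilies F) (X : LeftMod C) [Injective X] :
    Injective (F ⋙ X) :=
  have := preservesMonomorphisms_lan h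
  (F.lanAdjunction AddCommGrpCat.{u}).map_injective X inferInstance

/-- Restriction of right modules along `F`. -/
abbrev restrict (F : D ⥤ C) : RightMod C ⥤ RightMod D := (Functor.whiskeringLeft _ _ _).obj F.op

/-- The dual of a restricted module is the restriction of the dual, so flatness is preserved by
`injective_comp`. -/
theorem hasFlatResolution_restrict (h : HasDiscreteFinalFamilies F) {n : ℕ} {M : RightMod C}
    (hM : HasFlatResolution n M) : HasFlatResolution n ((restrict F).obj M) := by
  refine hM.map _ fun P hP => ?_
  rw [isFlat_iff_injective_rightDual] at hP ⊢
  exact injective_comp h (rightDual P)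

/-- Induction of right modules along `F`. -/
abbrev induce (F : D ⥤ C) : RightMod D ⥤ RightMod C := F.op.lan

/-- Induction is left adjoint to restriction. -/
abbrev induceAdjunction (F : D ⥤ C) : induce F ⊣ restrict F :=
  F.op.lanAdjunction AddCommGrpCat.{u}

instance : Limits.PreservesFiniteColimits (induce F) :=
  have := (induceAdjunction F).leftAdjoint_preservesColimits
  inferInstance

/-- Swapping duals around the adjunction identifies maps `N ⟶ (ind M)^*` with maps `F ⋙ N ⟶ M^*`,
and restriction preserves monomorphisms. -/
theorem isFlat_induce {M : RightMod D} (hM : IsFlat M) : IsFlat ((induce F).obj M) := by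
  rw [isFlat_iff_injective_rightDual] at hM ⊢
  constructor
  intro N N' g f _
  let e := fun L : LeftMod C => (dualSwap ((induce F).obj M) L).symm.trans
    (((induceAdjunction F).homEquiv M (leftDual L)).trans (dualSwap M (F ⋙ L)))
  have he : ∀ k, e N (f ≫ k) = Functor.whiskerLeft F f ≫ e N' k := by
    intro k
    obtain ⟨k, rfl⟩ := (dualSwap ((induce F).obj M) N').surjective k
    rw [← dualSwap_comp_leftDualMap]
    dsimp only [e, Equiv.trans_apply]
    rw [Equiv.symm_apply_apply, Equiv.symm_apply_apply, Adjunction.homEquiv_naturality_right]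
    rfl
  have : Mono (Functor.whiskerLeft F f) := by
    rw [NatTrans.mono_iff_mono_app]
    exact fun d => inferInstanceAs (Mono (f.app (F.obj d)))
  refine ⟨(e N').symm (Injective.factorThru (e N g) (Functor.whiskerLeft F f)),
    (e N).injective ?_⟩
  rw [he, Equiv.apply_symm_apply, Injective.comp_factorThru]

theorem hasFlatResolution_induce (h : HasDiscreteFinalFamilies F.op) {n : ℕ} {M : RightMod D}
    (hM : HasFlatResolution n M) : HasFlatResolution n ((induce F).obj M) :=
  have := preservesFiniteLimits_lan h
  hM.map _ fun _ => isFlat_induce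

theorem hasProjectiveDimensionLT_induce (h : HasDiscreteFinalFamilies F.op) (n : ℕ)
    (M : RightMod D) (hM : HasProjectiveDimensionLT M n) :
    HasProjectiveDimensionLT ((induce F).obj M) n :=
  have := preservesFiniteLimits_lan h
  hasProjectiveDimensionLT_map (induce F)
    (fun P hP => (induceAdjunction F).map_projective P hP) n M hM

/-! ### Induction of the trivial module -/

/-- The free right module on a presheaf of sets. -/
abbrev freeMod (S : Cᵒᵖ ⥤ Type u) : RightMod C := S ⋙ AddCommGrpCat.free

theorem freeMod_hom_ext {S : Cᵒᵖ ⥤ Type u} {X : RightMod C} {f g : freeMod S ⟶ X}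
    (h : ∀ c (s : S.obj c), (f.app c).hom (FreeAbelianGroup.of s)
      = (g.app c).hom (FreeAbelianGroup.of s)) : f = g :=
  NatTrans.ext (funext fun c => AddCommGrpCat.hom_ext (FreeAbelianGroup.lift_ext _ _ (h c)))

/-- Maps out of a free module. -/
def freeModLift {S : Cᵒᵖ ⥤ Type u} {X : RightMod C} (x : ∀ c, S.obj c → X.obj c)
    (hx : ∀ ⦃c d⦄ (φ : c ⟶ d) (s : S.obj c), x d (S.map φ s) = (X.map φ).hom (x c s)) :
    freeMod S ⟶ X where
  app c := AddCommGrpCat.ofHom (FreeAbelianGroup.lift (x c))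
  naturality c d φ := AddCommGrpCat.hom_ext (FreeAbelianGroup.lift_ext _ _ fun s => by
    have h1 : (FreeAbelianGroup.lift (x d)) (FreeAbelianGroup.of (S.map φ s)) = x d (S.map φ s) :=
      FreeAbelianGroup.lift_apply_of _ _
    have h2 : (FreeAbelianGroup.lift (x c)) (FreeAbelianGroup.of s) = x c s :=
      FreeAbelianGroup.lift_apply_of _ _
    exact h1.trans ((hx φ s).trans (congrArg (X.map φ).hom h2.symm)))

theorem freeModLift_of {S : Cᵒᵖ ⥤ Type u} {X : RightMod C} (x : ∀ c, S.obj c → X.obj c)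
    (hx : ∀ ⦃c d⦄ (φ : c ⟶ d) (s : S.obj c), x d (S.map φ s) = (X.map φ).hom (x c s)) (c : Cᵒᵖ)
    (s : S.obj c) : ((freeModLift x hx).app c).hom (FreeAbelianGroup.of s) = x c s :=
  FreeAbelianGroup.lift_apply_of (x c) s

theorem freeMod_map_of (S : Cᵒᵖ ⥤ Type u) {c d : Cᵒᵖ} (φ : c ⟶ d) (s : S.obj c) :
    ((freeMod S).map φ).hom (FreeAbelianGroup.of s) = FreeAbelianGroup.of (S.map φ s) := rfl

/-- Maps from the trivial module to `X` are compatible families of elements of `X`. -/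
def trivialModLift {X : RightMod C} (x : ∀ c, X.obj c)
    (hx : ∀ ⦃c d⦄ (φ : c ⟶ d), (X.map φ).hom (x c) = x d) : trivialMod C ⟶ X where
  app c := AddCommGrpCat.ofHom ((zmultiplesHom (X.obj c) (x c)).comp
    AddEquiv.ulift.toAddMonoidHom)
  naturality c d φ := by
    ext ⟨k⟩
    change k • x d = (X.map φ).hom (k • x c)
    rw [map_zsmul, hx]

theorem trivialMod_hom_ext {X : RightMod C} {f g : trivialMod C ⟶ X}
    (h : ∀ c, (f.app c).hom (ULift.up (1 : ℤ)) = (g.app c).hom (ULift.up (1 : ℤ))) : f = g := by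
  refine NatTrans.ext (funext fun c => AddCommGrpCat.hom_ext (AddMonoidHom.ext fun ⟨k⟩ => ?_))
  have hk : (ULift.up k : ULift.{u} ℤ) = k • ULift.up (1 : ℤ) := by
    ext
    simp
  change (f.app c).hom (ULift.up k : ULift.{u} ℤ) = (g.app c).hom (ULift.up k : ULift.{u} ℤ)
  rw [hk]
  exact (map_zsmul (f.app c).hom k _).trans ((congrArg (k • ·) (h c)).trans
    (map_zsmul (g.app c).hom k _).symm)

/-- A section `t` of the presheaf `S` over `F` such that every element `s ∈ S(c)` has an initial
presentation as `u^* t_d` with `u : c ⟶ F(d)`. -/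
structure UniversalSection (F : D ⥤ C) (S : Cᵒᵖ ⥤ Type u) where
  t : ∀ d, S.obj (op (F.obj d))
  map_t : ∀ ⦃d d'⦄ (f : d ⟶ d'), S.map (F.map f).op (t d') = t d
  dom : ∀ {c} (_ : S.obj (op c)), D
  u : ∀ {c} (s : S.obj (op c)), c ⟶ F.obj (dom s)
  map_u : ∀ {c} (s : S.obj (op c)), S.map (u s).op (t (dom s)) = s
  desc : ∀ {c} {d} (v : c ⟶ F.obj d), dom (S.map v.op (t d)) ⟶ d
  fac : ∀ {c} {d} (v : c ⟶ F.obj d), u (S.map v.op (t d)) ≫ F.map (desc v) = v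
  uniq : ∀ {c} (s : S.obj (op c)) {d} (f g : dom s ⟶ d), u s ≫ F.map f = u s ≫ F.map g → f = g

namespace UniversalSection

variable {S : Cᵒᵖ ⥤ Type u} (σ : UniversalSection F S)

include σ

/-- Replacing the literal pullback by an equal section `s` avoids transport between different values
of `dom`. -/
theorem exists_desc {c : C} (s : S.obj (op c)) {d : D} (v : c ⟶ F.obj d)
    (h : S.map v.op (σ.t d) = s) : ∃ f : σ.dom s ⟶ d, σ.u s ≫ F.map f = v := by
  subst h
  exact ⟨σ.desc v, σ.fac v⟩

/-- An arrow `v : c ⟶ F(d)` receives exactly one map from the presentation of `v^* t_d`, and none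
from the presentation of any other section, since `t` is compatible. -/
theorem hasDiscreteFinalFamilies_op : HasDiscreteFinalFamilies F.op := by
  rintro ⟨c⟩
  refine ⟨S.obj (op c), fun s => CostructuredArrow.mk (Y := op (σ.dom s)) (σ.u s).op,
    fun j => ?_⟩
  obtain ⟨⟨d⟩, ⟨⟨⟩⟩, v⟩ := j
  let v' : c ⟶ F.obj d := v.unop
  refine ⟨⟨S.map v'.op (σ.t d), CostructuredArrow.homMk (σ.desc v').op
    (Quiver.Hom.unop_inj (σ.fac v'))⟩, ?_⟩
  rintro ⟨s, f⟩
  have hf : σ.u s ≫ F.map f.left.unop = v' :=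
    congrArg Quiver.Hom.unop (CostructuredArrow.w f)
  obtain rfl : S.map v'.op (σ.t d) = s := by
    rw [← hf, op_comp, Functor.map_comp_apply, σ.map_t, σ.map_u]
  congr 1
  refine CostructuredArrow.hom_ext _ _ (Quiver.Hom.unop_inj ?_)
  exact σ.uniq _ _ _ (hf.trans (σ.fac v').symm)

/-- The comparison of the induced trivial module with the free module on `S`. -/
def induceTrivialHom : (induce F).obj (trivialMod D) ⟶ freeMod S :=
  ((induceAdjunction F).homEquiv _ _).symm
    (trivialModLift (X := (restrict F).obj (freeMod S))
      (fun d => FreeAbelianGroup.of (σ.t d.unop))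
      fun _ _ φ => (freeMod_map_of S _ _).trans (congrArg _ (σ.map_t φ.unop)))

theorem homEquiv_induceTrivialHom_comp {X : RightMod C} (g : freeMod S ⟶ X) (d : Dᵒᵖ) :
    (((induceAdjunction F).homEquiv _ _ (σ.induceTrivialHom ≫ g)).app d).hom
      (ULift.up (1 : ℤ)) = (g.app (op (F.obj d.unop))).hom (FreeAbelianGroup.of (σ.t d.unop)) := by
  rw [Adjunction.homEquiv_naturality_right, induceTrivialHom, Equiv.apply_symm_apply]
  exact congrArg (g.app (op (F.obj d.unop))).hom (one_zsmul _)

/-- By Yoneda: maps from either module to `X` are compatible families in the groups `X(F(d))`, by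
adjunction on one side and by `s = u^* t` on the other. -/
instance isIso_induceTrivialHom : IsIso σ.induceTrivialHom := by
  apply isIso_of_coyoneda_map_bijective
  intro X
  constructor
  · intro g g' h
    refine freeMod_hom_ext fun c s => ?_
    obtain ⟨c⟩ := c
    have hd : ∀ d, (g.app (op (F.obj d))).hom (FreeAbelianGroup.of (σ.t d))
        = (g'.app (op (F.obj d))).hom (FreeAbelianGroup.of (σ.t d)) := by
      intro d
      have h' : σ.induceTrivialHom ≫ g = σ.induceTrivialHom ≫ g' := h
      have := σ.homEquiv_induceTrivialHom_comp g (op d)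
      rw [h'] at this
      exact this.symm.trans (σ.homEquiv_induceTrivialHom_comp g' (op d))
    have hg : ∀ k : freeMod S ⟶ X, (k.app (op c)).hom (FreeAbelianGroup.of s)
        = (X.map (σ.u s).op).hom
          ((k.app (op (F.obj (σ.dom s)))).hom (FreeAbelianGroup.of (σ.t (σ.dom s)))) := by
      intro k
      have h1 := congrArg (fun q => q.hom (FreeAbelianGroup.of (σ.t (σ.dom s))))
        (k.naturality (σ.u s).op)
      refine Eq.trans ?_ h1
      exact congrArg (fun z => (k.app (op c)).hom (FreeAbelianGroup.of z)) (σ.map_u s).symm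
    rw [hg, hg, hd]
  · intro k
    let x : ∀ d, X.obj (op (F.obj d)) := fun d =>
      (((induceAdjunction F).homEquiv _ _ k).app (op d)).hom (ULift.up (1 : ℤ))
    have hx : ∀ ⦃d d'⦄ (f : d ⟶ d'), (X.map (F.map f).op).hom (x d') = x d := fun d d' f =>
      (congrArg (fun q => q.hom (ULift.up (1 : ℤ)))
        (((induceAdjunction F).homEquiv _ _ k).naturality f.op)).symm
    refine ⟨freeModLift (fun c s => (X.map (σ.u s).op).hom (x (σ.dom s))) ?_, ?_⟩
    · intro c c' φ s
      -- Pulling back the presentation of `s` presents `φ^* s`, and is compared with the chosen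
      -- presentation of `φ^* s`.
      obtain ⟨f, hf⟩ := σ.exists_desc (S.map φ s) (φ.unop ≫ σ.u s) (by
        rw [op_comp, Functor.map_comp_apply, σ.map_u]
        rfl)
      rw [← hx f, ← AddCommGrpCat.comp_apply, ← X.map_comp, ← op_comp, hf, op_comp, X.map_comp]
      rfl
    · apply ((induceAdjunction F).homEquiv _ _).injective
      refine trivialMod_hom_ext fun d => ?_
      refine (σ.homEquiv_induceTrivialHom_comp _ d).trans ?_
      rw [freeModLift_of]
      obtain ⟨f, hf⟩ := σ.exists_desc (σ.t d.unop) (𝟙 (F.obj d.unop)) (by simp)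
      rw [← hx f, ← AddCommGrpCat.comp_apply, ← X.map_comp, ← op_comp, hf, op_id, X.map_id]
      rfl

theorem hasFlatResolution_freeMod {n : ℕ} (h : HasFlatResolution n (trivialMod D)) :
    HasFlatResolution n (freeMod S) :=
  (hasFlatResolution_induce σ.hasDiscreteFinalFamilies_op h).of_iso (asIso σ.induceTrivialHom)

theorem hasProjectiveDimensionLT_freeMod (n : ℕ)
    (h : HasProjectiveDimensionLT (trivialMod D) n) :
    HasProjectiveDimensionLT (freeMod S) n :=
  have := hasProjectiveDimensionLT_induce σ.hasDiscreteFinalFamilies_op n _ h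
  hasProjectiveDimensionLT_of_iso (asIso σ.induceTrivialHom) n

end UniversalSection

end KanExtension

/-! ### Maps between transitive `G`-sets -/

section Orbit

variable {G : Type u} [Group G]

/-- The `G`-map `G ⧸ X ⟶ Y` sending the trivial coset to `a`. -/
def orbitHom {X : Subgroup G} {Y : Type*} [MulAction G Y] (a : Y) (h : ∀ x ∈ X, x • a = a) :
    (G ⧸ X) →[G] Y where
  toFun := Quotient.lift (fun g : G => g • a) fun g g' hg => by
    have := h _ (QuotientGroup.leftRel_apply.1 hg)
    rw [mul_smul, inv_smul_eq_iff] at this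
    exact this.symm
  map_smul' g x := by
    induction x using QuotientGroup.induction_on with
    | H x => exact mul_smul g x a

@[simp]
theorem orbitHom_mk {X : Subgroup G} {Y : Type*} [MulAction G Y] (a : Y)
    (h : ∀ x ∈ X, x • a = a) (g : G) : orbitHom a h (g : G ⧸ X) = g • a := rfl

theorem orbit_map_mk {X : Subgroup G} {Y : Type*} [MulAction G Y] (f : (G ⧸ X) →[G] Y) (g : G) :
    f (g : G ⧸ X) = g • f ((1 : G) : G ⧸ X) := by
  rw [← map_smul]
  exact congrArg (fun z : G => f (z : G ⧸ X)) (mul_one g).symm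

theorem orbit_hom_ext {X : Subgroup G} {Y : Type*} [MulAction G Y] {f g : (G ⧸ X) →[G] Y}
    (h : f ((1 : G) : G ⧸ X) = g ((1 : G) : G ⧸ X)) : f = g := by
  ext x
  induction x using QuotientGroup.induction_on with
  | H x => rw [orbit_map_mk f, orbit_map_mk g, h]

theorem smul_orbit_map_one {X : Subgroup G} {Y : Type*} [MulAction G Y] (f : (G ⧸ X) →[G] Y)
    {x : G} (hx : x ∈ X) : x • f ((1 : G) : G ⧸ X) = f ((1 : G) : G ⧸ X) := by
  rw [← map_smul]
  exact congrArg f (QuotientGroup.eq.2 (by simpa using hx))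

variable {K : Subgroup G}

/-- The inclusion of `K ⧸ L` into `G ⧸ L`. -/
def cosetIncl (L : Subgroup K) : K ⧸ L → G ⧸ L.map K.subtype :=
  Quotient.map' K.subtype fun a b h => by
    rw [QuotientGroup.leftRel_apply] at h ⊢
    exact ⟨a⁻¹ * b, h, rfl⟩

theorem cosetIncl_mk (L : Subgroup K) (k : K) :
    cosetIncl L (k : K ⧸ L) = ((k : G) : G ⧸ L.map K.subtype) := rfl

theorem cosetIncl_smul {L : Subgroup K} (k : K) (x : K ⧸ L) :
    cosetIncl L (k • x) = (k : G) • cosetIncl L x := by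
  induction x using QuotientGroup.induction_on with
  | H x => rfl

theorem cosetIncl_injective (L : Subgroup K) : Function.Injective (cosetIncl L) := by
  intro x y h
  induction x using QuotientGroup.induction_on with
  | H x =>
    induction y using QuotientGroup.induction_on with
    | H y =>
      obtain ⟨l, hl, h⟩ := QuotientGroup.eq.1 h
      obtain rfl : l = x⁻¹ * y := Subtype.ext h
      exact QuotientGroup.eq.2 hl

/-- The projection `G ⧸ L ⟶ G ⧸ K` for `L ≤ K`. -/
def cosetProj {L K : Subgroup G} (h : L ≤ K) : (G ⧸ L) →[G] (G ⧸ K) :=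
  orbitHom ((1 : G) : G ⧸ K) fun x hx => QuotientGroup.eq.2 (by simpa using h hx)

theorem cosetProj_mk {L K : Subgroup G} (h : L ≤ K) (g : G) :
    cosetProj h (g : G ⧸ L) = (g : G ⧸ K) :=
  congrArg (fun z : G => (z : G ⧸ K)) (mul_one g)

theorem cosetProj_cosetIncl {L : Subgroup K} (x : K ⧸ L) :
    cosetProj (Subgroup.map_subtype_le L) (cosetIncl L x) = ((1 : G) : G ⧸ K) := by
  induction x using QuotientGroup.induction_on with
  | H x => exact (cosetProj_mk _ _).trans (QuotientGroup.eq.2 (by simp))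

theorem exists_cosetIncl_eq {L : Subgroup K} {y : G ⧸ L.map K.subtype}
    (h : cosetProj (Subgroup.map_subtype_le L) y = ((1 : G) : G ⧸ K)) :
    ∃ x, cosetIncl L x = y := by
  induction y using QuotientGroup.induction_on with
  | H y =>
    rw [cosetProj_mk, eq_comm, QuotientGroup.eq] at h
    exact ⟨((⟨y, by simpa using h⟩ : K) : K ⧸ L), rfl⟩

end Orbit

/-! ### Induction of orbit categories -/

section OrbitCat

variable {G : Type u} [Group G] {F : Set (Subgroup G)}

/-- The underlying `G`-map of a morphism of the orbit category. -/
abbrev OrbitCat.toMap {X Y : OrbitCat F} (f : X ⟶ Y) : (G ⧸ X.sub) →[G] (G ⧸ Y.sub) := f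

theorem OrbitCat.hom_ext {X Y : OrbitCat F} {f g : X ⟶ Y}
    (h : OrbitCat.toMap f ((1 : G) : G ⧸ X.sub) = OrbitCat.toMap g ((1 : G) : G ⧸ X.sub)) :
    f = g := orbit_hom_ext h

theorem OrbitCat.toMap_comp {X Y Z : OrbitCat F} (f : X ⟶ Y) (g : Y ⟶ Z) (x : G ⧸ X.sub) :
    OrbitCat.toMap (f ≫ g) x = OrbitCat.toMap g (OrbitCat.toMap f x) := rfl

variable {K : Subgroup G}

/-- Induction of `K`-sets to `G`-sets, as a functor between orbit categories. -/
def orbitInduction (hK : ∀ L ∈ restrictFamily F K, L.map K.subtype ∈ F) :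
    OrbitCat (restrictFamily F K) ⥤ OrbitCat F where
  obj L := ⟨L.sub.map K.subtype, hK _ L.mem⟩
  map {L L'} f := orbitHom (cosetIncl L'.sub (OrbitCat.toMap f ((1 : K) : K ⧸ L.sub))) (by
    rintro _ ⟨l, hl, rfl⟩
    exact (cosetIncl_smul l _).symm.trans
      (congrArg _ (smul_orbit_map_one (OrbitCat.toMap f) hl)))
  map_id L := OrbitCat.hom_ext (one_smul G _)
  map_comp {L L' L''} f g := OrbitCat.hom_ext (by
    refine (one_smul G _).trans ?_
    rw [OrbitCat.toMap_comp, OrbitCat.toMap_comp]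
    obtain ⟨k, hk⟩ := QuotientGroup.mk_surjective (OrbitCat.toMap f ((1 : K) : K ⧸ L.sub))
    change _ = orbitHom _ _ (orbitHom _ _ _)
    rw [orbitHom_mk, one_smul, ← hk, orbit_map_mk, cosetIncl_smul, cosetIncl_mk, orbitHom_mk])

variable (hK : ∀ L ∈ restrictFamily F K, L.map K.subtype ∈ F)

theorem orbitInduction_map_cosetIncl {L L' : OrbitCat (restrictFamily F K)} (f : L ⟶ L')
    (x : K ⧸ L.sub) : OrbitCat.toMap ((orbitInduction hK).map f) (cosetIncl L.sub x)
      = cosetIncl L'.sub (OrbitCat.toMap f x) := by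
  induction x using QuotientGroup.induction_on with
  | H x =>
    rw [orbit_map_mk, cosetIncl_smul]
    rfl

theorem orbitInduction_map_one {L L' : OrbitCat (restrictFamily F K)} (f : L ⟶ L') :
    OrbitCat.toMap ((orbitInduction hK).map f) ((1 : G) : G ⧸ _)
      = cosetIncl L'.sub (OrbitCat.toMap f ((1 : K) : K ⧸ L.sub)) :=
  orbitInduction_map_cosetIncl hK f ((1 : K) : K ⧸ L.sub)

/-- The stabilizer of `gX` in `K` is `gXg⁻¹ ∩ K`; closure under conjugation enters here. -/
theorem stabilizer_mem_restrictFamily (hF : IsFamily F) {X : Subgroup G} (hX : X ∈ F)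
    (x : G ⧸ X) : MulAction.stabilizer K x ∈ restrictFamily F K := by
  induction x using QuotientGroup.induction_on with
  | H g =>
    refine ⟨_, hF.conj_mem X hX g, ?_⟩
    ext k
    rw [MulAction.mem_stabilizer_iff, Subgroup.mem_subgroupOf, Subgroup.mem_map]
    have h1 : k • (g : G ⧸ X) = (((k : G) * g : G) : G ⧸ X) := rfl
    rw [h1, eq_comm, QuotientGroup.eq]
    constructor
    · exact fun h => ⟨_, h, by simp [mul_assoc]⟩
    · rintro ⟨x, hx, h⟩
      rw [← h]
      simpa [mul_assoc] using hx

/-- A `G`-map from `G/L` with `L ≤ K` is a `K`-map from `K/L`. Its image lies in exactly one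
`K`-orbit of the target, and it factors uniquely through that orbit, written as `K` modulo the
stabilizer of a chosen point. -/
theorem hasDiscreteFinalFamilies_orbitInduction (hF : IsFamily F) :
    HasDiscreteFinalFamilies (orbitInduction hK) := by
  intro c
  let S := MulAction.orbitRel.Quotient K (G ⧸ c.sub)
  let ob : S → OrbitCat (restrictFamily F K) := fun s =>
    ⟨MulAction.stabilizer K s.out, stabilizer_mem_restrictFamily hF c.mem _⟩
  let ar : ∀ s, (orbitInduction hK).obj (ob s) ⟶ c := fun s =>
    orbitHom s.out (by
      rintro _ ⟨k, hk, rfl⟩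
      exact hk)
  refine ⟨S, fun s => CostructuredArrow.mk (ar s), fun j => ?_⟩
  obtain ⟨L, ⟨⟨⟩⟩, φ⟩ := j
  change (orbitInduction hK).obj L ⟶ c at φ
  let y := OrbitCat.toMap φ ((1 : G) : G ⧸ _)
  have har : ∀ (s : S) (f : L ⟶ ob s) (k : K),
      OrbitCat.toMap f ((1 : K) : K ⧸ L.sub) = (k : K ⧸ _) →
      OrbitCat.toMap ((orbitInduction hK).map f ≫ ar s) ((1 : G) : G ⧸ _) = k • s.out := by
    intro s f k hk
    rw [OrbitCat.toMap_comp, orbitInduction_map_one, hk]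
    rfl
  obtain ⟨k, hk⟩ : ∃ k : K, k • (Quotient.mk'' y : S).out = y := by
    have : (Quotient.mk'' (Quotient.mk'' y : S).out : S) = Quotient.mk'' y :=
      Quotient.out_eq' _
    obtain ⟨k, hk⟩ := MulAction.orbitRel_apply.1 (Quotient.eq''.1 this.symm)
    exact ⟨k, hk⟩
  have hfix : ∀ l ∈ L.sub, l • y = y := fun l hl =>
    smul_orbit_map_one (OrbitCat.toMap φ) ⟨l, hl, rfl⟩
  let f : L ⟶ ob (Quotient.mk'' y) := orbitHom (X := L.sub)
    (k : K ⧸ MulAction.stabilizer K (Quotient.mk'' y : S).out) fun l hl => by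
      refine (QuotientGroup.eq.2 ?_).symm
      change (k⁻¹ * (l * k)) • _ = _
      rw [mul_smul, mul_smul, inv_smul_eq_iff, hk, hfix l hl]
  refine ⟨⟨Quotient.mk'' y, CostructuredArrow.homMk f (OrbitCat.hom_ext ?_)⟩, ?_⟩
  · refine (har _ f k ?_).trans hk
    exact one_smul K _
  · rintro ⟨s, q⟩
    have hq : ∀ k' : K, OrbitCat.toMap q.left ((1 : K) : K ⧸ L.sub) = (k' : K ⧸ _) →
        k' • s.out = y := fun k' hk' => (har s q.left k' hk').symm.trans
      (congrArg (fun z => OrbitCat.toMap z ((1 : G) : G ⧸ _)) (CostructuredArrow.w q))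
    obtain ⟨k', hk'⟩ := QuotientGroup.mk_surjective (OrbitCat.toMap q.left ((1 : K) : K ⧸ L.sub))
    have hy := hq k' hk'.symm
    obtain rfl : s = Quotient.mk'' y := by
      rw [← Quotient.out_eq' s]
      exact (Quotient.eq''.2 (MulAction.orbitRel_apply.2 ⟨k', hy⟩)).symm
    congr 1
    refine CostructuredArrow.hom_ext _ _ (OrbitCat.hom_ext (hk'.symm.trans ?_))
    refine Eq.trans (QuotientGroup.eq.2 ?_) (one_smul K _).symm
    change (k'⁻¹ * k) • _ = _
    rw [mul_smul, hk, inv_smul_eq_iff, hy]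

/-! ### The presheaf of maps into `G ⧸ K` and its universal section -/

theorem cosetProj_comp {X K K' : Subgroup G} (h : K ≤ K') (φ : (G ⧸ X) →[G] (G ⧸ K)) {g : G}
    (hg : (g : G ⧸ K) = φ ((1 : G) : G ⧸ X)) :
    (cosetProj h).comp φ ((1 : G) : G ⧸ X) = (g : G ⧸ K') := by
  rw [MulActionHom.comp_apply, ← hg, cosetProj_mk]

/-- The presheaf of maps into the `G`-set `G ⧸ K`, functorially in `K`. -/
def cosetPresheaf : Subgroup G ⥤ (OrbitCat F)ᵒᵖ ⥤ Type u where
  obj K :=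
    { obj H := (G ⧸ H.unop.sub) →[G] (G ⧸ K)
      map f := ↾fun φ => φ.comp (OrbitCat.toMap f.unop) }
  map {K K'} h := { app H := ↾fun φ => (cosetProj h.le).comp φ }
  map_id K := by
    refine NatTrans.ext (funext fun H => ConcreteCategory.hom_ext _ _ fun φ => ?_)
    obtain ⟨g, hg⟩ := QuotientGroup.mk_surjective (φ ((1 : G) : G ⧸ H.unop.sub))
    exact orbit_hom_ext ((cosetProj_comp le_rfl φ hg).trans hg)
  map_comp {K K' K''} h h' := by
    refine NatTrans.ext (funext fun H => ConcreteCategory.hom_ext _ _ fun φ => ?_)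
    obtain ⟨g, hg⟩ := QuotientGroup.mk_surjective (φ ((1 : G) : G ⧸ H.unop.sub))
    exact orbit_hom_ext ((cosetProj_comp (h ≫ h').le φ hg).trans
      (cosetProj_comp h'.le _ (cosetProj_comp h.le φ hg).symm).symm)

variable (F K) in
/-- The intersection of `K` with the conjugate of `H` by the inverse of a representative of the
image of a `G`-map `G ⧸ H ⟶ G ⧸ K`. -/
def fiberSubgroup {H : OrbitCat F} (s : (G ⧸ H.sub) →[G] (G ⧸ K)) : Subgroup K :=
  (H.sub.map (MulAut.conj (s ((1 : G) : G ⧸ H.sub)).out⁻¹).toMonoidHom).subgroupOf K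

theorem mem_fiberSubgroup {H : OrbitCat F} (s : (G ⧸ H.sub) →[G] (G ⧸ K)) (k : K) :
    k ∈ fiberSubgroup F K s ↔ (s ((1 : G) : G ⧸ H.sub)).out * k *
      (s ((1 : G) : G ⧸ H.sub)).out⁻¹ ∈ H.sub := by
  rw [fiberSubgroup, Subgroup.mem_subgroupOf, Subgroup.mem_map]
  constructor
  · rintro ⟨h, hh, hk⟩
    rw [← hk]
    simpa [mul_assoc] using hh
  · exact fun h => ⟨_, h, by simp [mul_assoc]⟩

/-- The restriction of the given representative to the fiber subgroup. -/
def fiberHom {H : OrbitCat F} (s : (G ⧸ H.sub) →[G] (G ⧸ K)) :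
    (G ⧸ H.sub) →[G] (G ⧸ (fiberSubgroup F K s).map K.subtype) :=
  orbitHom (((s ((1 : G) : G ⧸ H.sub)).out : G) : G ⧸ _) fun h hh => by
    refine (QuotientGroup.eq.2 ?_).symm
    -- With `g` the representative of `s(1)`, the element `h` fixes `gK`, so `g⁻¹hg` lies in `K`.
    have h1 : (s ((1 : G) : G ⧸ H.sub)).out⁻¹ * (h * (s ((1 : G) : G ⧸ H.sub)).out) ∈ K := by
      refine QuotientGroup.eq.1 (Eq.symm ?_)
      refine Eq.trans ?_ ((smul_orbit_map_one s hh).trans (QuotientGroup.out_eq' _).symm)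
      exact congrArg (h • ·) (QuotientGroup.out_eq' (s ((1 : G) : G ⧸ H.sub)))
    refine ⟨⟨_, h1⟩, (mem_fiberSubgroup s _).2 ?_, rfl⟩
    simpa [mul_assoc] using hh

theorem fiberHom_one {H : OrbitCat F} (s : (G ⧸ H.sub) →[G] (G ⧸ K)) :
    fiberHom s ((1 : G) : G ⧸ H.sub) = (((s ((1 : G) : G ⧸ H.sub)).out : G) : G ⧸ _) :=
  one_smul G _

theorem cosetProj_comp_fiberHom {H : OrbitCat F} (s : (G ⧸ H.sub) →[G] (G ⧸ K)) :
    (cosetProj (Subgroup.map_subtype_le _)).comp (fiberHom s) = s :=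
  orbit_hom_ext ((cosetProj_comp _ _ (fiberHom_one s).symm).trans (QuotientGroup.out_eq' _))

theorem smul_cosetIncl_comp_fiberHom {H : OrbitCat F} (s : (G ⧸ H.sub) →[G] (G ⧸ K))
    (hs : fiberSubgroup F K s ∈ restrictFamily F K) {d : OrbitCat (restrictFamily F K)}
    (f : (⟨_, hs⟩ : OrbitCat (restrictFamily F K)) ⟶ d) :
    OrbitCat.toMap ((orbitInduction hK).map f) (fiberHom s ((1 : G) : G ⧸ H.sub))
      = (s ((1 : G) : G ⧸ H.sub)).out • cosetIncl d.sub (OrbitCat.toMap f ((1 : K) : K ⧸ _)) :=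
  (congrArg (OrbitCat.toMap ((orbitInduction hK).map f)) (fiberHom_one s)).trans
    ((orbit_map_mk _ _).trans (congrArg _ (orbitInduction_map_one hK f)))

/-- With `g` the representative of `s(1)`, the point `g⁻¹v(1)` lies over the trivial coset, hence in
`K/d`. It is fixed by `K ∩ g⁻¹Hg`, so it defines the factor. -/
theorem exists_fiberHom_fac {H : OrbitCat F} {d : OrbitCat (restrictFamily F K)}
    (v : (G ⧸ H.sub) →[G] (G ⧸ d.sub.map K.subtype)) (s : (G ⧸ H.sub) →[G] (G ⧸ K))
    (hv : (cosetProj (Subgroup.map_subtype_le d.sub)).comp v = s)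
    (hs : fiberSubgroup F K s ∈ restrictFamily F K) :
    ∃ f : (⟨_, hs⟩ : OrbitCat (restrictFamily F K)) ⟶ d,
      (OrbitCat.toMap ((orbitInduction hK).map f)).comp (fiberHom s) = v := by
  have hg : cosetProj (Subgroup.map_subtype_le d.sub) (v ((1 : G) : G ⧸ H.sub))
      = ((s ((1 : G) : G ⧸ H.sub)).out : G ⧸ K) :=
    (DFunLike.congr_fun hv _).trans (QuotientGroup.out_eq' _).symm
  obtain ⟨x, hx⟩ := exists_cosetIncl_eq (L := d.sub)
    (y := (s ((1 : G) : G ⧸ H.sub)).out⁻¹ • v ((1 : G) : G ⧸ H.sub)) (by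
      rw [map_smul, hg]
      exact congrArg (fun z : G => (z : G ⧸ K)) (inv_mul_cancel _))
  refine ⟨orbitHom (X := fiberSubgroup F K s) x fun k hk => cosetIncl_injective _ ?_,
    orbit_hom_ext ?_⟩
  · have h := smul_orbit_map_one v ((mem_fiberSubgroup s k).1 hk)
    rw [mul_smul, mul_smul] at h
    rw [cosetIncl_smul, hx, eq_inv_smul_iff]
    exact h
  · refine (smul_cosetIncl_comp_fiberHom hK s hs _).trans ?_
    refine Eq.trans (congrArg (fun z => _ • cosetIncl d.sub z) (one_smul K x)) ?_
    exact (congrArg _ hx).trans (smul_inv_smul _ _)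

/-- Every `G`-map `G ⧸ H ⟶ G ⧸ K` factors initially through an orbit induced from `K`. -/
def cosetUniversalSection (hF : IsFamily F) :
    UniversalSection (orbitInduction hK) (cosetPresheaf.obj K) where
  t d := cosetProj (Subgroup.map_subtype_le d.sub)
  map_t d d' f := orbit_hom_ext (by
    refine (congrArg (cosetProj (Subgroup.map_subtype_le d'.sub))
      (orbitInduction_map_one hK f)).trans ?_
    exact (cosetProj_cosetIncl _).trans (cosetProj_mk _ _).symm)
  dom {H} s := ⟨fiberSubgroup F K s, ⟨_, hF.conj_mem _ H.mem _, rfl⟩⟩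
  u s := fiberHom s
  map_u s := cosetProj_comp_fiberHom s
  desc v := (exists_fiberHom_fac hK v _ rfl _).choose
  fac v := (exists_fiberHom_fac hK v _ rfl _).choose_spec
  uniq {H} s d f f' h := OrbitCat.hom_ext (cosetIncl_injective _ (by
    have h1 := congrArg (fun z => OrbitCat.toMap z ((1 : G) : G ⧸ H.sub)) h
    exact smul_left_cancel _ ((smul_cosetIncl_comp_fiberHom hK s _ f).symm.trans
      (h1.trans (smul_cosetIncl_comp_fiberHom hK s _ f')))))

/-! ### The trivial module as a directed colimit -/

section Colimit

universe v w

variable {J : Type v} [Category.{w} J] (Φ : J ⥤ Subgroup G)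

/-- The cocone of the presheaves of maps into `G ⧸ K` over the one-point presheaf. -/
def cosetCocone : Limits.Cocone (Φ ⋙ cosetPresheaf (F := F)) where
  pt := (Functor.const _).obj PUnit
  ι :=
    { app j := { app H := ↾fun _ => PUnit.unit } }

/-- Maps sending the trivial coset to `gΦ_i` and `g'Φ_i` become equal once the subgroup contains
`g⁻¹g'`. -/
theorem exists_map_eq_of_isFiltered [IsFiltered J] (hΦ : ∀ g, ∃ j, g ∈ Φ.obj j)
    {X : Subgroup G} {i : J} (s s' : (G ⧸ X) →[G] (G ⧸ Φ.obj i)) :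
    ∃ (k : J) (f : i ⟶ k),
      (cosetProj (Φ.map f).le).comp s = (cosetProj (Φ.map f).le).comp s' := by
  obtain ⟨g, hg⟩ := QuotientGroup.mk_surjective (s ((1 : G) : G ⧸ X))
  obtain ⟨g', hg'⟩ := QuotientGroup.mk_surjective (s' ((1 : G) : G ⧸ X))
  obtain ⟨j, hj⟩ := hΦ (g⁻¹ * g')
  refine ⟨IsFiltered.max i j, IsFiltered.leftToMax i j, orbit_hom_ext ?_⟩
  rw [cosetProj_comp _ s hg, cosetProj_comp _ s' hg']
  exact QuotientGroup.eq.2 ((Φ.map (IsFiltered.rightToMax i j)).le hj)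

/-- The directed system of free modules on the presheaves of maps into `G ⧸ K`. -/
abbrev cosetModules : J ⥤ RightMod (OrbitCat F) :=
  (Φ ⋙ cosetPresheaf) ⋙ (Functor.whiskeringRight _ _ _).obj AddCommGrpCat.free

/-- The cocone over the directed system of free modules. -/
abbrev cosetModulesCocone : Limits.Cocone (cosetModules (F := F) Φ) :=
  ((Functor.whiskeringRight _ _ _).obj AddCommGrpCat.free).mapCocone (cosetCocone Φ)

/-- The free module on the one-point presheaf is the colimit of the free modules on the
presheaves of maps into `G ⧸ K`, for a directed system of subgroups `K` which exhausts `G` and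
eventually contains every member of `F`. -/
def isColimitCosetModulesCocone [IsFiltered J] (hΦ : ∀ g, ∃ j, g ∈ Φ.obj j)
    (hΦF : ∀ H ∈ F, ∃ j, H ≤ Φ.obj j) :
    Limits.IsColimit (cosetModulesCocone (F := F) Φ) :=
  -- Colimits are pointwise and the free functor is a left adjoint, so it suffices that the sets of
  -- maps `G/H → G/Φ_j` have a one-point colimit: one of them is non-empty, and any two elements are
  -- eventually identified.
  Limits.evaluationJointlyReflectsColimits _ fun H =>
    Limits.isColimitOfPreserves AddCommGrpCat.free
      (c := ((evaluation _ _).obj H).mapCocone (cosetCocone (F := F) Φ))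
      (Limits.Types.FilteredColimit.isColimitOf' _ _
        (fun _ => (hΦF _ H.unop.mem).imp fun _ hj => ⟨cosetProj hj, rfl⟩)
        fun _ s s' _ => exists_map_eq_of_isFiltered Φ hΦ s s')

/-- The trivial module is free on the one-point presheaf. -/
def trivialModIso : (cosetModulesCocone (F := F) Φ).pt ≅ trivialMod (OrbitCat F) :=
  NatIso.ofComponents
    (fun _ => AddEquiv.toAddCommGrpIso
      ((FreeAbelianGroup.uniqueEquiv PUnit).trans AddEquiv.ulift.symm))
    fun _ => AddCommGrpCat.hom_ext (FreeAbelianGroup.lift_ext _ _ fun _ => rfl)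

end Colimit

end OrbitCat

/-! ### Projective dimension of coproducts and sequential colimits -/

theorem projective_sigma {A : Type*} [Category A] {ι : Type*} (X : ι → A)
    [Limits.HasCoproduct X] (h : ∀ i, Projective (X i)) : Projective (∐ X) where
  factors f e _ := ⟨Limits.Sigma.desc fun i => Projective.factorThru (Limits.Sigma.ι X i ≫ f) e,
    Limits.Sigma.hom_ext _ _ fun i => by
      rw [← Category.assoc, Limits.Sigma.ι_desc, Projective.factorThru_comp]⟩

theorem hasProjectiveDimensionLT_sigma {A : Type*} [Category A] [Abelian A] [EnoughProjectives A]
    {ι : Type*} [Limits.HasColimitsOfShape (Discrete ι) A]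
    [HasExactColimitsOfShape (Discrete ι) A] (n : ℕ) (X : ι → A)
    (h : ∀ i, HasProjectiveDimensionLT (X i) n) : HasProjectiveDimensionLT (∐ X) n := by
  induction n generalizing X with
  | zero =>
    simp only [hasProjectiveDimensionLT_zero_iff_isZero] at h ⊢
    rw [Limits.IsZero.iff_id_eq_zero]
    exact Limits.Sigma.hom_ext _ _ fun i => (h i).eq_of_src _ _
  | succ n ih =>
    cases n with
    | zero =>
      exact projective_iff_hasProjectiveDimensionLT_one.1
        (projective_sigma X fun i => projective_iff_hasProjectiveDimensionLT_one.2 (h i))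
    | succ n =>
      choose S hS hP hX using fun i => exists_shortExact_projective (X i)
      obtain rfl : (fun i => (S i).X₃) = X := funext hX
      let T : ShortComplex (Discrete ι ⥤ A) :=
        { X₁ := Discrete.functor fun i => (S i).X₁
          X₂ := Discrete.functor fun i => (S i).X₂
          X₃ := Discrete.functor fun i => (S i).X₃
          f := Discrete.natTrans fun i => (S i.as).f
          g := Discrete.natTrans fun i => (S i.as).g
          zero := by
            ext i
            exact (S i.as).zero }
      have hT : (T.map Limits.colim).ShortExact :=
        (shortExact_of_evaluation (S := T) fun i => hS i.as).map_of_exact Limits.colim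
      have : Projective (T.map Limits.colim).X₂ :=
        projective_sigma (fun i => (S i).X₂) hP
      exact (hT.hasProjectiveDimensionLT_X₃_iff n this).2
        (ih (fun i => (S i).X₁) fun i => ((hS i).hasProjectiveDimensionLT_X₃_iff n (hP i)).1 (h i))

/-! ### The telescope of a sequence of modules -/

section Telescope

variable {C : Type*} [Category C]

theorem iSup_range_sigmaι {ι : Type} (X : ι → C ⥤ AddCommGrpCat.{u}) (c : C) :
    ⨆ i, ((Limits.Sigma.ι X i).app c).hom.range = ⊤ := by
  rw [← QuotientAddGroup.ker_mk' (⨆ i, ((Limits.Sigma.ι X i).app c).hom.range),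
    AddMonoidHom.ker_eq_top_iff]
  have h := (Limits.isColimitOfPreserves ((evaluation C AddCommGrpCat.{u}).obj c)
    (Limits.coproductIsCoproduct X)).hom_ext
    (f := AddCommGrpCat.ofHom (QuotientAddGroup.mk'
      (⨆ i, ((Limits.Sigma.ι X i).app c).hom.range))) (f' := 0) fun i => by
    ext x
    exact (QuotientAddGroup.eq_zero_iff _).2
      (AddSubgroup.mem_iSup_of_mem i.as ⟨x, rfl⟩)
  exact congrArg AddCommGrpCat.Hom.hom h

/-- Elements of a coproduct have finite support. Allowing every larger `t` makes the claim additive: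
for a sum, take the union of the supports. -/
theorem eq_sum_sigmaι {ι : Type} [DecidableEq ι] (X : ι → C ⥤ AddCommGrpCat.{u}) (c : C)
    (x : (∐ X : C ⥤ AddCommGrpCat.{u}).obj c) :
    ∃ s : Finset ι, ∀ t : Finset ι, s ⊆ t →
      x = ∑ i ∈ t, ((Limits.Sigma.ι X i).app c).hom (((Limits.Sigma.π X i).app c).hom x) := by
  have hx : x ∈ ⨆ i, ((Limits.Sigma.ι X i).app c).hom.range := by
    rw [iSup_range_sigmaι]
    trivial
  induction hx using AddSubgroup.iSup_induction' with
  | hp i x hx =>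
    obtain ⟨y, rfl⟩ := hx
    refine ⟨{i}, fun t ht => ?_⟩
    rw [Finset.sum_eq_single_of_mem i (ht (by simp))]
    · have := congrArg (fun q => (q.app c).hom y) (Limits.Sigma.ι_π_eq_id X i)
      exact (congrArg ((Limits.Sigma.ι X i).app c).hom this).symm
    · intro j _ hj
      have := congrArg (fun q => (q.app c).hom y) (Limits.Sigma.ι_π_of_ne X hj.symm)
      exact (congrArg ((Limits.Sigma.ι X j).app c).hom this).trans (map_zero _)
  | h1 => exact ⟨∅, fun t _ => by simp⟩
  | hadd x y _ _ hx hy =>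
    obtain ⟨s, hs⟩ := hx
    obtain ⟨s', hs'⟩ := hy
    refine ⟨s ∪ s', fun t ht => ?_⟩
    simp only [map_add, Finset.sum_add_distrib]
    rw [← hs t (Finset.union_subset_left ht), ← hs' t (Finset.union_subset_right ht)]

theorem eq_zero_of_comp_sigmaπ {ι : Type} [DecidableEq ι] {X : ι → C ⥤ AddCommGrpCat.{u}}
    {Z : C ⥤ AddCommGrpCat.{u}} (z : Z ⟶ ∐ X) (h : ∀ i, z ≫ Limits.Sigma.π X i = 0) : z = 0 := by
  ext c x
  obtain ⟨s, hs⟩ := eq_sum_sigmaι X c ((z.app c).hom x)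
  refine (hs s subset_rfl).trans (Finset.sum_eq_zero fun i _ => ?_)
  have := congrArg (fun q => (q.app c).hom x) (h i)
  exact (congrArg _ this).trans (map_zero _)

variable (X : ℕ ⥤ C ⥤ AddCommGrpCat.{u})

/-- The difference of the identity and the shift on the coproduct of a sequence. -/
def oneSubShift : ∐ X.obj ⟶ ∐ X.obj :=
  Limits.Sigma.desc fun n =>
    Limits.Sigma.ι X.obj n - X.map (homOfLE n.le_succ) ≫ Limits.Sigma.ι X.obj (n + 1)

theorem ι_oneSubShift (n : ℕ) : Limits.Sigma.ι X.obj n ≫ oneSubShift X =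
    Limits.Sigma.ι X.obj n - X.map (homOfLE n.le_succ) ≫ Limits.Sigma.ι X.obj (n + 1) :=
  Limits.Sigma.ι_desc _ _

theorem oneSubShift_π_zero :
    oneSubShift X ≫ Limits.Sigma.π X.obj 0 = Limits.Sigma.π X.obj 0 := by
  refine Limits.Sigma.hom_ext _ _ fun n => ?_
  rw [← Category.assoc, ι_oneSubShift, Preadditive.sub_comp, Category.assoc,
    Limits.Sigma.ι_π_of_ne X.obj (Nat.succ_ne_zero n), Limits.comp_zero, sub_zero]

theorem oneSubShift_π_succ (n : ℕ) : oneSubShift X ≫ Limits.Sigma.π X.obj (n + 1) =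
    Limits.Sigma.π X.obj (n + 1)
      - Limits.Sigma.π X.obj n ≫ X.map (homOfLE n.le_succ) := by
  refine Limits.Sigma.hom_ext _ _ fun m => ?_
  rw [← Category.assoc, ι_oneSubShift, Preadditive.sub_comp, Preadditive.comp_sub,
    Category.assoc (X.map _)]
  congr 1
  rw [← Category.assoc (Limits.Sigma.ι X.obj m)]
  obtain rfl | hmn := eq_or_ne m n
  · rw [Limits.Sigma.ι_π_eq_id, Limits.Sigma.ι_π_eq_id, Category.comp_id, Category.id_comp]
  · rw [Limits.Sigma.ι_π_of_ne X.obj hmn, Limits.Sigma.ι_π_of_ne X.obj (by omega),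
      Limits.comp_zero, Limits.zero_comp]

/-- The map is triangular: if it kills `z`, the component of `z` at 0 vanishes, and each later
component is the shift of the previous one. -/
instance : Mono (oneSubShift X) := by
  refine Preadditive.mono_of_cancel_zero (oneSubShift X) fun {_} z hz => eq_zero_of_comp_sigmaπ z fun n => ?_
  induction n with
  | zero => rw [← oneSubShift_π_zero, ← Category.assoc, hz, Limits.zero_comp]
  | succ n ih =>
    have h := congrArg (z ≫ ·) (oneSubShift_π_succ X n)
    rw [← Category.assoc, hz, Limits.zero_comp, Preadditive.comp_sub, ← Category.assoc, ih,
      Limits.zero_comp, sub_zero] at h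
    exact h.symm

variable {X} (c : Limits.Cocone X)

theorem oneSubShift_desc : oneSubShift X ≫ Limits.Sigma.desc c.ι.app = 0 := by
  refine Limits.Sigma.hom_ext _ _ fun n => ?_
  rw [← Category.assoc, ι_oneSubShift, Preadditive.sub_comp, Category.assoc,
    Limits.Sigma.ι_desc, Limits.Sigma.ι_desc, c.w, sub_self, Limits.comp_zero]

variable {c}

/-- The telescope of a sequence: `0 → ∐ X_n → ∐ X_n → colim X_n → 0`. -/
theorem shortExact_telescope (hc : Limits.IsColimit c) :
    (ShortComplex.mk _ _ (oneSubShift_desc c)).ShortExact := by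
  have hepi : Epi (Limits.Sigma.desc c.ι.app) := by
    constructor
    intro W f g h
    refine hc.hom_ext fun n => ?_
    have := congrArg (Limits.Sigma.ι X.obj n ≫ ·) h
    simpa using this
  refine { exact := ShortComplex.exact_of_g_is_cokernel _ (Limits.CokernelCofork.IsColimit.ofπ' _ _
    fun {W} k hk => ?_), epi_g := hepi, mono_f := inferInstanceAs (Mono (oneSubShift X)) }
  -- A map killing identity minus shift is a cocone on consecutive steps, which suffices over ℕ.
  have hk' : ∀ n, X.map (homOfLE n.le_succ) ≫ Limits.Sigma.ι X.obj (n + 1) ≫ k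
      = (Limits.Sigma.ι X.obj n ≫ k) := by
    intro n
    have := congrArg (Limits.Sigma.ι X.obj n ≫ ·) hk
    dsimp only at this
    rw [← Category.assoc, ι_oneSubShift, Preadditive.sub_comp, Limits.comp_zero, sub_eq_zero,
      Category.assoc] at this
    exact this.symm
  refine ⟨hc.desc ⟨W, NatTrans.ofSequence (fun n => Limits.Sigma.ι X.obj n ≫ k) fun n => ?_⟩,
    Limits.Sigma.hom_ext _ _ fun n => ?_⟩
  · exact (hk' n).trans (Category.comp_id _).symm
  · rw [← Category.assoc, Limits.Sigma.ι_desc, hc.fac]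
    rfl

theorem hasProjectiveDimensionLT_of_isColimit_nat [EnoughProjectives (C ⥤ AddCommGrpCat.{u})]
    (hc : Limits.IsColimit c) (n : ℕ) (h : ∀ i, HasProjectiveDimensionLT (X.obj i) n) :
    HasProjectiveDimensionLT c.pt (n + 1) := by
  have h1 := hasProjectiveDimensionLT_sigma n X.obj h
  exact (shortExact_telescope hc).hasProjectiveDimensionLT_X₃ n h1
    (hasProjectiveDimensionLT_of_ge _ n _ n.le_succ)

end Telescope

/-! ### Directed unions of groups -/

section DirectedUnion

variable {G : Type u} [Group G] {F : Set (Subgroup G)}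

/-- The restriction of the constant module is the constant module by definition. -/
theorem hd_restrictFamily_le (hF : IsFamily F) {K : Subgroup G}
    (hK : ∀ L ∈ restrictFamily F K, L.map K.subtype ∈ F) {n : ℕ} (h : hd G F ≤ n) :
    hd K (restrictFamily F K) ≤ n := by
  rw [hd, flatDimension_le_iff] at h ⊢
  exact hasFlatResolution_restrict (hasDiscreteFinalFamilies_orbitInduction hK hF) h

theorem hd_le_of_directed (hF : IsFamily F) {J : Type u} [SmallCategory J] [IsFiltered J]
    (Φ : J ⥤ Subgroup G) (hΦ : ∀ g, ∃ j, g ∈ Φ.obj j) (hΦF : ∀ H ∈ F, ∃ j, H ≤ Φ.obj j)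
    (hΦK : ∀ j, ∀ L ∈ restrictFamily F (Φ.obj j), L.map (Φ.obj j).subtype ∈ F) {n : ℕ}
    (h : ∀ j, hd (Φ.obj j) (restrictFamily F (Φ.obj j)) ≤ n) : hd G F ≤ n := by
  simp only [hd, flatDimension_le_iff] at h ⊢
  exact (HasFlatResolution.of_isColimit (isColimitCosetModulesCocone Φ hΦ hΦF) fun j =>
    (cosetUniversalSection (hΦK j) hF).hasFlatResolution_freeMod (h j)).of_iso (trivialModIso Φ)

theorem hasProjectiveDimensionLT_trivialMod_of_sequence (hF : IsFamily F)
    (Φ : ℕ ⥤ Subgroup G) (hΦ : ∀ g, ∃ j, g ∈ Φ.obj j) (hΦF : ∀ H ∈ F, ∃ j, H ≤ Φ.obj j)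
    (hΦK : ∀ j, ∀ L ∈ restrictFamily F (Φ.obj j), L.map (Φ.obj j).subtype ∈ F) (n : ℕ)
    (h : ∀ j, HasProjectiveDimensionLT (trivialMod (OrbitCat (restrictFamily F (Φ.obj j)))) n) :
    HasProjectiveDimensionLT (trivialMod (OrbitCat F)) (n + 1) :=
  have := hasProjectiveDimensionLT_of_isColimit_nat (isColimitCosetModulesCocone Φ hΦ hΦF) n
    fun j => (cosetUniversalSection (hΦK j) hF).hasProjectiveDimensionLT_freeMod n (h j)
  hasProjectiveDimensionLT_of_iso (trivialModIso Φ) (n + 1)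

/-- Excludes the value `⊥` of the projective dimension, for which adding 1 has no effect. -/
theorem not_isZero_trivialMod {C : Type u} [SmallCategory C] [Nonempty C] :
    ¬ Limits.IsZero (trivialMod C) := by
  intro h
  obtain ⟨c⟩ := ‹Nonempty C›
  have h1 : Limits.IsZero (AddCommGrpCat.of (ULift.{u} ℤ)) := (Functor.isZero_iff _).1 h (op c)
  have h2 := AddCommGrpCat.subsingleton_of_isZero h1
  exact one_ne_zero (ULift.up_injective (Subsingleton.elim (ULift.up.{u} (1 : ℤ)) (ULift.up 0)))

end DirectedUnion

end

end BredonTheory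

/-! ### The proposition -/

open BredonTheory

theorem mainTheorem4 {G : Type u} [Group G] {ι : Type*} (Gl : ι → Subgroup G)
    (hdir : Directed (· ≤ ·) Gl) (hunion : ∀ g : G, ∃ l, g ∈ Gl l)
    (F : Set (Subgroup G)) (hF : BredonTheory.IsFamily F)
    (hFl : F = ⋃ l, (Subgroup.map (Gl l).subtype) '' BredonTheory.restrictFamily F (Gl l)) :
    BredonTheory.hd G F
        = ⨆ l, BredonTheory.hd (Gl l) (BredonTheory.restrictFamily F (Gl l)) ∧
      (Countable ι →
        BredonTheory.cd G F
          ≤ (⨆ l, BredonTheory.cd (Gl l) (BredonTheory.restrictFamily F (Gl l))) + 1) := by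
  have hK : ∀ l, ∀ L ∈ restrictFamily F (Gl l), L.map (Gl l).subtype ∈ F := by
    intro l L hL
    rw [hFl]
    exact Set.mem_iUnion.2 ⟨l, L, hL, rfl⟩
  have hle : ∀ H ∈ F, ∃ l, H ≤ Gl l := by
    intro H hH
    rw [hFl] at hH
    obtain ⟨l, L, _, rfl⟩ := Set.mem_iUnion.1 hH
    exact ⟨l, Subgroup.map_subtype_le L⟩
  obtain ⟨l₀, _⟩ := hunion 1
  have : Nonempty ι := ⟨l₀⟩
  constructor
  · refine le_antisymm ?_ (iSup_le fun l => ?_)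
    · cases h : ⨆ l, hd (Gl l) (restrictFamily F (Gl l)) with
      | top => exact le_top
      | coe n =>
        -- The range of `Gl` replaces `ι`: it lives in the universe of `G`, as the colimit requires,
        -- and is ordered by inclusion.
        have : IsDirectedOrder (Set.range Gl) :=
          ⟨by
            rintro ⟨_, i, rfl⟩ ⟨_, j, rfl⟩
            obtain ⟨k, hik, hjk⟩ := hdir i j
            exact ⟨⟨_, k, rfl⟩, hik, hjk⟩⟩
        let Φ : Set.range Gl ⥤ Subgroup G := (Subtype.mono_coe (· ∈ Set.range Gl)).functor
        refine hd_le_of_directed hF Φ (fun g => ?_) (fun H hH => ?_) ?_ ?_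
        · obtain ⟨l, hl⟩ := hunion g
          exact ⟨⟨_, l, rfl⟩, hl⟩
        · obtain ⟨l, hl⟩ := hle H hH
          exact ⟨⟨_, l, rfl⟩, hl⟩
        · rintro ⟨_, l, rfl⟩
          exact hK l
        · rintro ⟨_, l, rfl⟩
          exact (le_iSup (fun l => hd (Gl l) (restrictFamily F (Gl l))) l).trans h.le
    · cases h : hd G F with
      | top => exact le_top
      | coe n => exact hd_restrictFamily_le hF (hK l) h.le
  · intro _
    have := Encodable.ofCountable ι
    have : Inhabited ι := ⟨l₀⟩
    -- A countable directed family has a cofinal increasing sequence.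
    let Φ : ℕ ⥤ Subgroup G :=
      (show Monotone fun n => Gl (hdir.sequence Gl n) from hdir.sequence_mono).functor
    have hΦ : ∀ l, ∃ n, Gl l ≤ Φ.obj n := fun l => ⟨_, hdir.le_sequence l⟩
    induction h : ⨆ l, cd (Gl l) (restrictFamily F (Gl l)) with
    | bot =>
      obtain ⟨H, hH⟩ := hF.nonempty
      have : Nonempty (OrbitCat (restrictFamily F (Gl l₀))) :=
        ⟨⟨H.subgroupOf (Gl l₀), H, hH, rfl⟩⟩
      exact absurd ((projectiveDimension_eq_bot_iff _).1 (iSup_eq_bot.1 h l₀))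
        not_isZero_trivialMod
    | coe s =>
      cases s with
      | top => exact le_top
      | coe n =>
        refine (projectiveDimension_le_iff _ (n + 1)).2 ?_
        refine hasProjectiveDimensionLT_trivialMod_of_sequence hF Φ
          (fun g => ?_) (fun H hH => ?_) (fun j => hK _) (n + 1) fun j => ?_
        · obtain ⟨l, hl⟩ := hunion g
          exact (hΦ l).imp fun n hn => hn hl
        · obtain ⟨l, hl⟩ := hle H hH
          exact (hΦ l).imp fun n hn => hl.trans hn
        · exact (projectiveDimension_le_iff _ n).1
            ((le_iSup (fun l => cd (Gl l) (restrictFamily F (Gl l))) _).trans h.le)
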